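/- A binary code of length $n$ is a subspace of $\mathbb{F}_2^n$; it is self-dual if $C=C^\perp$, and a self-dual code is singly even if it has a codeword of weight $\equiv 2 \pmod 4$. For a singly even self-dual code $C$ let $C_0$ be the subcode of codewords of weight divisible by $4$; the shadow of $C$ is $S=C_0^\perp\setminus C$. For length $n=24m+2$, $C$ is a code with minimal shadow if the minimum weight of $S$ is $1$. An $[n,k,d]$ code is a code of length $n$, dimension $k$ and minimum weight $d$. Theorem. Let $m\ge 1$ be an integer. For rational numbers $c_0,\dots,c_{3m}$ put $$W_c(y)=\sum_{j=0}^{3m}c_j(1+y^2)^{12m+1-4j}\bigl(y^2(1-y^2)^2\bigr)^j=\sum_{i=0}^{12m+1}a_iy^{2i},$$ $$V_c(y)=\sum_{j=0}^{3m}(-1)^jc_j2^{12m+1-6j}y^{12m+1-4j}(1-y^4)^{2j}=\sum_{i=0}^{6m}b_iy^{4i+1}.$$ 1. There is exactly one $(c_0,\dots,c_{3m})\in\mathbb{Q}^{3m+1}$ such that $a_0=1$, $a_1=\dots=a_{2m}=0$, $b_0=1$ and $b_i=0$ for $1\le i\le m-1$. 2. If $C$ is a singly even self-dual $[24m+2,12m+1,4m+2]$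 code with minimal shadow and $S$ is its shadow, then, with this $c$, the weight enumerator of $C$ is $W_c(y)$ and the weight enumerator of $S$ is $V_c(y)$. 3. With this $c$, all coefficients of $W_c(y)$ and $V_c(y)$ are nonnegative integers if and only if $m\le 154$. 4. In particular, for $m\ge 155$ there is no singly even self-dual $[24m+2,12m+1,4m+2]$ code with minimal shadow. -/

import Mathlib

open Polynomial

noncomputable section

namespace BinaryCode

/-- A binary code of length `n`: a linear subspace of `𝔽₂ⁿ`. -/
abbrev Code (n : ℕ) := Submodule (ZMod 2) (Fin n → ZMod 2)

/-- The dual `{x ∣ x · y = 0 for all y ∈ S}` with respect to the standard inner product. -/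
def dual {n : ℕ} (S : Set (Fin n → ZMod 2)) : Code n where
  carrier := {x | ∀ y ∈ S, x ⬝ᵥ y = 0}
  add_mem' := by
    intro a b ha hb y hy
    rw [add_dotProduct, ha y hy, hb y hy, add_zero]
  zero_mem' := by
    intro y _
    exact zero_dotProduct y
  smul_mem' := by
    intro c x hx y hy
    rw [smul_dotProduct, hx y hy, smul_zero]

/-- `C` is self-dual: `C = C^⊥`. -/
def IsSelfDual {n : ℕ} (C : Code n) : Prop :=
  C = dual (C : Set (Fin n → ZMod 2))

/-- `C` is a singly even self-dual code: it is self-dual and has a codeword whose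
(Hamming) weight is congruent to `2` modulo `4`. -/
def IsSinglyEvenSelfDual {n : ℕ} (C : Code n) : Prop :=
  IsSelfDual C ∧ ∃ x ∈ C, hammingNorm x % 4 = 2

/-- The set `C₀` of codewords of weight divisible by `4`. -/
def doublyEvenPart {n : ℕ} (C : Code n) : Set (Fin n → ZMod 2) :=
  {x | x ∈ C ∧ 4 ∣ hammingNorm x}

/-- The shadow `S = C₀^⊥ \ C`. -/
def shadow {n : ℕ} (C : Code n) : Set (Fin n → ZMod 2) :=
  (dual (doublyEvenPart C) : Set (Fin n → ZMod 2)) \ (C : Set (Fin n → ZMod 2))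

/-- `d` is the minimum weight of `S`: the least weight of a nonzero vector of `S`
(in particular `S` has a nonzero vector). -/
def HasMinWeight {n : ℕ} (S : Set (Fin n → ZMod 2)) (d : ℕ) : Prop :=
  IsLeast {w | ∃ x ∈ S, x ≠ 0 ∧ hammingNorm x = w} d

/-- `C` is an `[n, k, d]` code: it has length `n`, dimension `k` and minimum weight `d`. -/
def HasParameters {n : ℕ} (C : Code n) (k d : ℕ) : Prop :=
  Module.finrank (ZMod 2) C = k ∧ HasMinWeight (C : Set (Fin n → ZMod 2)) d

/-- The number `r`, equal to `4, 1, 2, 3` for `n ≡ 0, 2, 4, 6` modulo `8` (self-dual codes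
have even length, so that odd `n` do not matter). -/
def minimalShadowWeight (n : ℕ) : ℕ :=
  if n % 8 = 0 then 4 else n % 8 / 2

/-- `C` has minimal shadow: the minimum weight of its shadow is `r`. -/
def HasMinimalShadow {n : ℕ} (C : Code n) : Prop :=
  HasMinWeight (shadow C) (minimalShadowWeight n)

open Classical in
/-- The weight enumerator `∑_{x ∈ S} y^{wt(x)}`. -/
def weightEnumerator {n : ℕ} (S : Set (Fin n → ZMod 2)) : ℚ[X] :=
  ∑ x : Fin n → ZMod 2 with x ∈ S, X ^ hammingNorm x

/-- The polynomial
`∑_{j=0}^{3m} c_j (1 + y²)^{12m+1-4j} (y² (1 - y²)²)^j`. -/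
def codeForm (m : ℕ) (c : Fin (3 * m + 1) → ℚ) : ℚ[X] :=
  ∑ j : Fin (3 * m + 1),
    C (c j) * (1 + X ^ 2) ^ (12 * m + 1 - 4 * (j : ℕ)) *
      (X ^ 2 * (1 - X ^ 2) ^ 2) ^ (j : ℕ)

/-- The polynomial
`∑_{j=0}^{3m} (-1)^j c_j 2^{12m+1-6j} y^{12m+1-4j} (1 - y⁴)^{2j}`
(the exponent `12m+1-6j` of `2` may be negative). -/
def shadowForm (m : ℕ) (c : Fin (3 * m + 1) → ℚ) : ℚ[X] :=
  ∑ j : Fin (3 * m + 1),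
    C ((-1) ^ (j : ℕ) * c j * (2 : ℚ) ^ (12 * (m : ℤ) + 1 - 6 * ((j : ℕ) : ℤ))) *
      X ^ (12 * m + 1 - 4 * (j : ℕ)) * (1 - X ^ 4) ^ (2 * (j : ℕ))

/-- The conditions on the weight enumerators `∑ a_i y^{2i}` and `∑ b_i y^{4i+1}` coming from
minimum weight `4m+2` and minimal shadow:
`a_0 = 1`, `a_1 = ⋯ = a_{2m} = 0`, `b_0 = 1`, `b_1 = ⋯ = b_{m-1} = 0`. -/
def IsAdmissible (m : ℕ) (c : Fin (3 * m + 1) → ℚ) : Prop :=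
  (codeForm m c).coeff 0 = 1 ∧
  (∀ i, 1 ≤ i → i ≤ 2 * m → (codeForm m c).coeff (2 * i) = 0) ∧
  (shadowForm m c).coeff 1 = 1 ∧
  (∀ i, 1 ≤ i → i ≤ m - 1 → (shadowForm m c).coeff (4 * i + 1) = 0)

/-- All coefficients of `P` are nonnegative integers. -/
def HasNonnegIntCoeffs (P : ℚ[X]) : Prop :=
  ∀ i, ∃ k : ℕ, P.coeff i = (k : ℚ)

end BinaryCode

end

open Polynomial

noncomputable section

namespace BinaryCode

/-! ### The two forms in the variables `u = y²` and `t = y⁴` -/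

/-! Write u = y² and t = y⁴. With g = u(1-u)²/(1+u)⁴ the code form is (1+u)^(12m+1) ∑ c_j g^j. With
h = t/(1-t)² the shadow form is y (1-t)^(6m) ∑ d_j h^(3m-j), where d_j = (-1)^j c_j 2^(12m+1-6j).
Both g and h have a simple zero at 0, so Lagrange inversion (`coeff_residue`) recovers c_J from a_0,
…, a_J and d_J from b_0, …, b_{3m-J}. The conditions on the a_i therefore control c_0, …, c_{2m} and
those on the b_i control the rest. This is a square linear system with trivial kernel
(`conditionMap_injective`), hence unique solvability.

For a code, the MacWilliams identity makes the weight enumerator invariant under y ↦ (1-y)/(1+y).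
Choose c to match a_0, …, a_{3m}. The difference to the code form is an even invariant vanishing at
0 to an order too high for its degree, so it is zero (`eq_zero_of_invariant`). MacWilliams for the
doubly even subcode then gives the shadow form. Admissibility holds because two distinct shadow
vectors differ by a nonzero codeword, and one of them has weight 1.

For m ≥ 155 the numbers c_{2m+1}, …, c_{2m+4} are expressed twice: in closed form through the b_i,
and by inversion through a_{2m+1}, …, a_{2m+4}. Eliminating the first three unknowns shows that
a_{2m+4} is a positive factor times an explicit polynomial of degree 13 in m, which is negative from
155 on (`IsAdmissible.coeff_codeFormSq_neg`). A negative coefficient cannot count codewords.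

For m ≤ 154 a candidate list of the |c_j| is produced and tested. The forms are evaluated at a large
power of two, and all coefficients are read off as binary digits (`coeff_eq_digit`,
`exists_of_certificate`). Uniqueness identifies the candidate with the admissible c. -/

/-- `codeForm` in the variable `u = y²`. -/
def codeFormSq {R : Type*} [CommRing R] (m : ℕ) (c : Fin (3 * m + 1) → R) : R[X] :=
  ∑ j : Fin (3 * m + 1),
    C (c j) * (1 + X) ^ (12 * m + 1 - 4 * (j : ℕ)) * (X * (1 - X) ^ 2) ^ (j : ℕ)

/-- `shadowForm`, divided by `y`, in the variable `t = y⁴`. -/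
def shadowFormFourth {R : Type*} [CommRing R] (m : ℕ) (d : Fin (3 * m + 1) → R) : R[X] :=
  ∑ j : Fin (3 * m + 1), C (d j) * X ^ (3 * m - (j : ℕ)) * (1 - X) ^ (2 * (j : ℕ))

/-- The coefficients of the shadow form. -/
def shadowCoeff (m : ℕ) (c : Fin (3 * m + 1) → ℚ) (j : Fin (3 * m + 1)) : ℚ :=
  (-1) ^ (j : ℕ) * c j * (2 : ℚ) ^ (12 * (m : ℤ) + 1 - 6 * ((j : ℕ) : ℤ))

theorem codeForm_eq_expand (m : ℕ) (c : Fin (3 * m + 1) → ℚ) :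
    codeForm m c = expand ℚ 2 (codeFormSq m c) := by
  simp [codeForm, codeFormSq, map_sum]

theorem shadowForm_eq_X_mul_expand (m : ℕ) (c : Fin (3 * m + 1) → ℚ) :
    shadowForm m c = X * expand ℚ 4 (shadowFormFourth m (shadowCoeff m c)) := by
  simp only [shadowForm, shadowFormFourth, shadowCoeff, map_sum, map_mul, map_pow, map_sub,
    map_one, expand_X, expand_C, Finset.mul_sum]
  refine Finset.sum_congr rfl fun j _ => ?_
  have hj : (j : ℕ) ≤ 3 * m := by omega
  have h : 12 * m + 1 - 4 * (j : ℕ) = 4 * (3 * m - j) + 1 := by omega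
  rw [h]
  ring

theorem coeff_codeForm (m : ℕ) (c : Fin (3 * m + 1) → ℚ) (i : ℕ) :
    (codeForm m c).coeff (2 * i) = (codeFormSq m c).coeff i := by
  rw [codeForm_eq_expand, coeff_expand_mul' (by norm_num)]

theorem coeff_shadowForm (m : ℕ) (c : Fin (3 * m + 1) → ℚ) (i : ℕ) :
    (shadowForm m c).coeff (4 * i + 1) = (shadowFormFourth m (shadowCoeff m c)).coeff i := by
  rw [shadowForm_eq_X_mul_expand, coeff_X_mul, coeff_expand_mul' (by norm_num)]

theorem isAdmissible_iff {m : ℕ} {c : Fin (3 * m + 1) → ℚ} :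
    IsAdmissible m c ↔ (codeFormSq m c).coeff 0 = 1 ∧
      (∀ i, 1 ≤ i → i ≤ 2 * m → (codeFormSq m c).coeff i = 0) ∧
      (shadowFormFourth m (shadowCoeff m c)).coeff 0 = 1 ∧
      (∀ i, 1 ≤ i → i ≤ m - 1 → (shadowFormFourth m (shadowCoeff m c)).coeff i = 0) := by
  have h1 := coeff_codeForm m c 0
  have h2 := coeff_shadowForm m c 0
  simp only [mul_zero, zero_add] at h1 h2
  simp only [IsAdmissible, coeff_codeForm, coeff_shadowForm, h1, h2]

/-! ### Lagrange inversion -/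

/-- A formal residue: `Res g^{j-J-1} g' = δ_{jJ}` for `g = Xφ`, where `ψ = φ⁻¹` and
`θ = X g' / g`. -/
theorem coeff_residue {φ ψ θ : PowerSeries ℚ} (h : φ * ψ = 1)
    (hθ : ψ * θ = ψ - PowerSeries.X * PowerSeries.derivative ℚ ψ)
    (hc : PowerSeries.constantCoeff ψ = 1) (j J : ℕ) :
    PowerSeries.coeff J ((PowerSeries.X * φ) ^ j * (ψ ^ J * θ)) = if j = J then 1 else 0 := by
  rcases lt_trichotomy j J with hj | rfl | hj
  · obtain ⟨M, rfl⟩ : ∃ M, J = M + 1 + j := ⟨J - j - 1, by omega⟩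
    have e : (PowerSeries.X * φ) ^ j * (ψ ^ (M + 1 + j) * θ)
        = PowerSeries.X ^ j * (ψ ^ M * (ψ * θ)) := by
      have : (φ * ψ) ^ j = 1 := by rw [h, one_pow]
      calc _ = (φ * ψ) ^ j * (PowerSeries.X ^ j * (ψ ^ M * (ψ * θ))) := by ring
        _ = _ := by rw [this, one_mul]
    rw [e, PowerSeries.coeff_X_pow_mul, if_neg (by omega), hθ]
    -- Here ψ^M (ψ - Xψ') = ψ^(M+1) - X(ψ^(M+1))'/(M+1), and the operator X d/dX multiplies the
    -- coefficient of X^(M+1) by M+1.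
    have h2 : ((M : ℚ) + 1) * PowerSeries.coeff (M + 1)
          (ψ ^ M * (ψ - PowerSeries.X * PowerSeries.derivative ℚ ψ)) = 0 := by
      have hd : PowerSeries.derivative ℚ (ψ ^ (M + 1)) =
          PowerSeries.C ((M : ℚ) + 1) * (ψ ^ M * PowerSeries.derivative ℚ ψ) := by
        rw [PowerSeries.derivative_pow]; simp; ring
      have hc := congrArg (PowerSeries.coeff M) hd
      rw [PowerSeries.coeff_derivative, PowerSeries.coeff_C_mul] at hc
      have : ψ ^ M * (ψ - PowerSeries.X * PowerSeries.derivative ℚ ψ)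
          = ψ ^ (M + 1) - PowerSeries.X * (ψ ^ M * PowerSeries.derivative ℚ ψ) := by ring
      rw [this, map_sub, PowerSeries.coeff_succ_X_mul, mul_sub]
      linarith
    have h3 : ((M : ℚ) + 1) ≠ 0 := by positivity
    exact (mul_eq_zero.mp h2).resolve_left h3
  · have e : (PowerSeries.X * φ) ^ j * (ψ ^ j * θ) = PowerSeries.X ^ j * θ := by
      calc _ = (φ * ψ) ^ j * (PowerSeries.X ^ j * θ) := by ring
        _ = _ := by rw [h, one_pow, one_mul]
    have := congrArg PowerSeries.constantCoeff hθ
    simp only [map_mul, map_sub, hc, one_mul, PowerSeries.constantCoeff_X, zero_mul,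
      sub_zero] at this
    rw [e, PowerSeries.coeff_X_pow_mul', if_pos le_rfl, if_pos rfl, Nat.sub_self,
      PowerSeries.coeff_zero_eq_constantCoeff_apply, this]
  · rw [mul_pow, mul_assoc, PowerSeries.coeff_X_pow_mul', if_neg (by omega), if_neg (by omega)]

theorem coeff_mul_eq_zero_of_forall_le {J : ℕ} {f : PowerSeries ℚ}
    (hf : ∀ i ≤ J, PowerSeries.coeff i f = 0) (S : PowerSeries ℚ) :
    PowerSeries.coeff J (f * S) = 0 := by
  rw [PowerSeries.coeff_mul]
  refine Finset.sum_eq_zero fun p hp => ?_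
  have hp' := Finset.HasAntidiagonal.mem_antidiagonal.mp hp
  rw [hf _ (by omega), zero_mul]

/-- The power series `1 / (1 - X)`. -/
def geom : PowerSeries ℚ := PowerSeries.mk 1

/-- The power series `1 / (1 + X)`. -/
def altGeom : PowerSeries ℚ := (1 + PowerSeries.X)⁻¹

theorem one_sub_mul_geom : (1 - PowerSeries.X) * geom = 1 := by
  rw [mul_comm]; exact PowerSeries.mk_one_mul_one_sub_eq_one ℚ

theorem one_add_mul_altGeom : (1 + PowerSeries.X) * altGeom = 1 :=
  PowerSeries.mul_inv_cancel _ (by simp)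

theorem constantCoeff_geom : PowerSeries.constantCoeff geom = 1 := by
  simpa using congrArg PowerSeries.constantCoeff one_sub_mul_geom

theorem derivative_geom : PowerSeries.derivative ℚ geom = geom ^ 2 := by
  have h := congrArg (PowerSeries.derivative ℚ) one_sub_mul_geom
  simp only [Derivation.leibniz, map_sub, PowerSeries.derivative_one, PowerSeries.derivative_X,
    smul_eq_mul] at h
  linear_combination geom * h - PowerSeries.derivative ℚ geom * one_sub_mul_geom

theorem coeff_geom_pow (d n : ℕ) :
    PowerSeries.coeff n (geom ^ (d + 1)) = ((d + n).choose d : ℚ) := by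
  rw [geom, PowerSeries.mk_one_pow_eq_mk_choose_add, PowerSeries.coeff_mk]

/-- The kernel that recovers `c_J` from `codeFormSq`. -/
def codeKernel (m J : ℕ) : PowerSeries ℚ :=
  altGeom ^ (12 * m + 1) * (((1 + PowerSeries.X) ^ 4 * geom ^ 2) ^ J *
    ((1 - 6 * PowerSeries.X + PowerSeries.X ^ 2) * altGeom * geom))

/-- Lagrange inversion for g = X(1-X)²/(1+X)⁴ = Xφ. The factor θ = X g'/g = 1 - 2X/(1-X) - 4X/(1+X)
equals (1-6X+X²)/(1-X²), and `altGeom ^ (12 * m + 1)` cancels the prefactor (1+X)^(12m+1). -/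
theorem coeff_codeFormSq_mul_codeKernel (m : ℕ) (c : Fin (3 * m + 1) → ℚ)
    (J : Fin (3 * m + 1)) :
    PowerSeries.coeff J ((codeFormSq m c : PowerSeries ℚ) * codeKernel m J) = c J := by
  have hg := one_sub_mul_geom
  have ha := one_add_mul_altGeom
  set φ : PowerSeries ℚ := (1 - PowerSeries.X) ^ 2 * altGeom ^ 4 with hφ
  set ψ : PowerSeries ℚ := (1 + PowerSeries.X) ^ 4 * geom ^ 2 with hψ
  set θ : PowerSeries ℚ := (1 - 6 * PowerSeries.X + PowerSeries.X ^ 2) * altGeom * geom with hθ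
  have h1 : φ * ψ = 1 := by
    calc φ * ψ = ((1 - PowerSeries.X) * geom) ^ 2 * ((1 + PowerSeries.X) * altGeom) ^ 4 := by
          rw [hφ, hψ]; ring
      _ = 1 := by rw [hg, ha]; simp
  have h2 : ψ * θ = ψ - PowerSeries.X * PowerSeries.derivative ℚ ψ := by
    have : PowerSeries.derivative ℚ ψ = 4 * (1 + PowerSeries.X) ^ 3 * geom ^ 2 +
        2 * (1 + PowerSeries.X) ^ 4 * geom ^ 3 := by
      rw [hψ]
      simp only [Derivation.leibniz, PowerSeries.derivative_pow, derivative_geom, map_add,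
        PowerSeries.derivative_one, PowerSeries.derivative_X, smul_eq_mul]
      push_cast
      ring
    rw [this, hψ, hθ]
    have e1 : (1 + PowerSeries.X) ^ 4 * altGeom = (1 + PowerSeries.X) ^ 3 := by
      linear_combination (1 + PowerSeries.X) ^ 3 * ha
    have e2 : (1 + PowerSeries.X) ^ 3 * geom ^ 2 =
        (1 + PowerSeries.X) ^ 3 * (1 - PowerSeries.X) * geom ^ 3 := by
      linear_combination -(1 + PowerSeries.X) ^ 3 * geom ^ 2 * hg
    have e3 : (1 + PowerSeries.X) ^ 4 * geom ^ 2 =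
        (1 + PowerSeries.X) ^ 4 * (1 - PowerSeries.X) * geom ^ 3 := by
      linear_combination -(1 + PowerSeries.X) ^ 4 * geom ^ 2 * hg
    linear_combination (geom ^ 3 * (1 - 6 * PowerSeries.X + PowerSeries.X ^ 2)) * e1
      - e3 + 4 * PowerSeries.X * e2
  have h3 : PowerSeries.constantCoeff ψ = 1 := by simp [hψ, constantCoeff_geom]
  have key : (codeFormSq m c : PowerSeries ℚ) * codeKernel m J =
      ∑ j : Fin (3 * m + 1), PowerSeries.C (c j) *
        ((PowerSeries.X * φ) ^ (j : ℕ) * (ψ ^ (J : ℕ) * θ)) := by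
    simp only [codeFormSq, ← Polynomial.coeToPowerSeries.ringHom_apply, map_sum, Finset.sum_mul]
    refine Finset.sum_congr rfl fun j _ => ?_
    simp only [map_mul, map_pow, map_add, map_sub, map_one,
      Polynomial.coeToPowerSeries.ringHom_apply, Polynomial.coe_C, Polynomial.coe_X, codeKernel]
    obtain ⟨k, hk⟩ : ∃ k, 12 * m + 1 = k + 4 * (j : ℕ) := ⟨12 * m + 1 - 4 * j, by omega⟩
    rw [hk, Nat.add_sub_cancel]
    have : ((1 + PowerSeries.X) * altGeom) ^ k = 1 := by rw [ha, one_pow]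
    calc _ = ((1 + PowerSeries.X) * altGeom) ^ k * (PowerSeries.C (c j) *
          ((PowerSeries.X * φ) ^ (j : ℕ) * (ψ ^ (J : ℕ) * θ))) := by
          rw [hφ, hψ, hθ]
          generalize (1 + PowerSeries.X : PowerSeries ℚ) = p
          generalize (1 - PowerSeries.X : PowerSeries ℚ) = q
          simp only [mul_pow]
          ring
      _ = _ := by rw [this, one_mul]
  rw [key, map_sum]
  simp only [PowerSeries.coeff_C_mul, coeff_residue h1 h2 h3]
  simp [Fin.val_inj]

/-- The kernel that recovers the coefficient of `t^k (1 - t)^{6m - 2k}` in `shadowFormFourth`. -/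
def shadowKernel (m k : ℕ) : PowerSeries ℚ :=
  geom ^ (6 * m) * (((1 - PowerSeries.X) ^ 2) ^ k * ((1 + PowerSeries.X) * geom))

/-- Same inversion for h = X/(1-X)², for which X h'/h = (1+X)/(1-X); the form is (1-X)^(6m) ∑ d_j
h^(3m-j), so the order of the indices is reversed. -/
theorem coeff_shadowFormFourth_mul_shadowKernel (m : ℕ) (d : Fin (3 * m + 1) → ℚ)
    (J : Fin (3 * m + 1)) :
    PowerSeries.coeff (3 * m - J) ((shadowFormFourth m d : PowerSeries ℚ) *
      shadowKernel m (3 * m - J)) = d J := by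
  have hg := one_sub_mul_geom
  set φ : PowerSeries ℚ := geom ^ 2 with hφ
  set ψ : PowerSeries ℚ := (1 - PowerSeries.X) ^ 2 with hψ
  set θ : PowerSeries ℚ := (1 + PowerSeries.X) * geom with hθ
  have h1 : φ * ψ = 1 := by
    calc φ * ψ = ((1 - PowerSeries.X) * geom) ^ 2 := by rw [hφ, hψ]; ring
      _ = 1 := by rw [hg]; simp
  have h2 : ψ * θ = ψ - PowerSeries.X * PowerSeries.derivative ℚ ψ := by
    have : PowerSeries.derivative ℚ ψ = -2 * (1 - PowerSeries.X) := by
      rw [hψ]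
      simp only [PowerSeries.derivative_pow, map_sub,
        PowerSeries.derivative_one, PowerSeries.derivative_X]
      push_cast
      ring
    rw [this, hψ, hθ]
    linear_combination (1 - PowerSeries.X) * (1 + PowerSeries.X) * hg
  have h3 : PowerSeries.constantCoeff ψ = 1 := by simp [hψ]
  have key : (shadowFormFourth m d : PowerSeries ℚ) * shadowKernel m (3 * m - J) =
      ∑ j : Fin (3 * m + 1), PowerSeries.C (d j) *
        ((PowerSeries.X * φ) ^ (3 * m - (j : ℕ)) * (ψ ^ (3 * m - (J : ℕ)) * θ)) := by
    simp only [shadowFormFourth, ← Polynomial.coeToPowerSeries.ringHom_apply, map_sum,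
      Finset.sum_mul]
    refine Finset.sum_congr rfl fun j _ => ?_
    simp only [map_mul, map_pow, map_sub, map_one,
      Polynomial.coeToPowerSeries.ringHom_apply, Polynomial.coe_C, Polynomial.coe_X, shadowKernel]
    obtain ⟨k, hk⟩ : ∃ k, 3 * m - (j : ℕ) = k := ⟨_, rfl⟩
    have hk' : 6 * m = 2 * k + 2 * j := by omega
    rw [hk, hk']
    have : ((1 - PowerSeries.X) * geom) ^ (2 * (j : ℕ)) = 1 := by rw [hg, one_pow]
    calc _ = ((1 - PowerSeries.X) * geom) ^ (2 * (j : ℕ)) * (PowerSeries.C (d j) *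
          ((PowerSeries.X * φ) ^ k * (ψ ^ (3 * m - (J : ℕ)) * θ))) := by
          rw [hφ, hψ, hθ]
          generalize (1 - PowerSeries.X : PowerSeries ℚ) = q
          simp only [mul_pow]
          ring
      _ = _ := by rw [this, one_mul]
  rw [key, map_sum]
  simp only [PowerSeries.coeff_C_mul, coeff_residue h1 h2 h3]
  rw [Finset.sum_eq_single J]
  · simp
  · intro b _ hb
    rw [if_neg, mul_zero]
    intro h
    exact hb (Fin.ext (by omega))
  · simp

/-! ### Linearity and unique solvability of the conditions -/

theorem codeFormSq_add_smul (m : ℕ) (a : ℚ) (c c' : Fin (3 * m + 1) → ℚ) :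
    codeFormSq m (a • c + c') = a • codeFormSq m c + codeFormSq m c' := by
  simp only [codeFormSq, Finset.smul_sum, ← Finset.sum_add_distrib]
  refine Finset.sum_congr rfl fun j _ => ?_
  simp only [Pi.add_apply, Pi.smul_apply, smul_eq_mul, map_add, map_mul, smul_eq_C_mul]
  ring

theorem shadowFormFourth_add_smul (m : ℕ) (a : ℚ) (c c' : Fin (3 * m + 1) → ℚ) :
    shadowFormFourth m (a • c + c') = a • shadowFormFourth m c + shadowFormFourth m c' := by
  simp only [shadowFormFourth, Finset.smul_sum, ← Finset.sum_add_distrib]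
  refine Finset.sum_congr rfl fun j _ => ?_
  simp only [Pi.add_apply, Pi.smul_apply, smul_eq_mul, map_add, map_mul, smul_eq_C_mul]
  ring

theorem shadowCoeff_add_smul (m : ℕ) (a : ℚ) (c c' : Fin (3 * m + 1) → ℚ) :
    shadowCoeff m (a • c + c') = a • shadowCoeff m c + shadowCoeff m c' := by
  ext j
  simp only [shadowCoeff, Pi.add_apply, Pi.smul_apply, smul_eq_mul]
  ring

theorem eq_zero_of_coeff_codeFormSq {m : ℕ} {c : Fin (3 * m + 1) → ℚ} (J : Fin (3 * m + 1))
    (h : ∀ i ≤ (J : ℕ), (codeFormSq m c).coeff i = 0) : c J = 0 := by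
  rw [← coeff_codeFormSq_mul_codeKernel m c J]
  exact coeff_mul_eq_zero_of_forall_le (fun i hi => by simpa using h i hi) _

theorem eq_zero_of_coeff_shadowFormFourth {m : ℕ} {d : Fin (3 * m + 1) → ℚ}
    (J : Fin (3 * m + 1))
    (h : ∀ i ≤ 3 * m - (J : ℕ), (shadowFormFourth m d).coeff i = 0) : d J = 0 := by
  rw [← coeff_shadowFormFourth_mul_shadowKernel m d J]
  exact coeff_mul_eq_zero_of_forall_le (fun i hi => by simpa using h i hi) _

theorem shadowCoeff_eq_zero_iff {m : ℕ} {c : Fin (3 * m + 1) → ℚ} {j : Fin (3 * m + 1)} :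
    shadowCoeff m c j = 0 ↔ c j = 0 := by
  have : (2 : ℚ) ^ (12 * (m : ℤ) + 1 - 6 * ((j : ℕ) : ℤ)) ≠ 0 := zpow_ne_zero _ (by norm_num)
  simp [shadowCoeff, this]

/-- `a_0, …, a_{3m}` as a linear function of the `c_j`. -/
def codeCoeffMap (m : ℕ) : (Fin (3 * m + 1) → ℚ) →ₗ[ℚ] (Fin (3 * m + 1) → ℚ) where
  toFun c i := (codeFormSq m c).coeff i
  map_add' c c' := by
    ext i
    have := codeFormSq_add_smul m 1 c c'
    rw [one_smul, one_smul] at this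
    simp [this]
  map_smul' a c := by
    ext i
    have := codeFormSq_add_smul m a c 0
    have h0 : codeFormSq m (0 : Fin (3 * m + 1) → ℚ) = 0 := by simp [codeFormSq]
    rw [add_zero, h0, add_zero] at this
    simp [this]

theorem codeCoeffMap_surjective (m : ℕ) : Function.Surjective (codeCoeffMap m) := by
  rw [← LinearMap.injective_iff_surjective, ← LinearMap.ker_eq_bot, LinearMap.ker_eq_bot']
  intro c hc
  ext J
  refine eq_zero_of_coeff_codeFormSq J fun i hi => ?_
  exact congrFun hc ⟨i, by omega⟩

/-- `a_0, …, a_{2m}, b_{m-1}, …, b_0` as a linear function of the `c_j`. -/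
def conditionMap (m : ℕ) : (Fin (3 * m + 1) → ℚ) →ₗ[ℚ] (Fin (3 * m + 1) → ℚ) where
  toFun c i := if (i : ℕ) ≤ 2 * m then (codeFormSq m c).coeff i
    else (shadowFormFourth m (shadowCoeff m c)).coeff (3 * m - i)
  map_add' c c' := by
    ext i
    have h1 := codeFormSq_add_smul m 1 c c'
    have h2 := shadowFormFourth_add_smul m 1 (shadowCoeff m c) (shadowCoeff m c')
    have h3 := shadowCoeff_add_smul m 1 c c'
    rw [one_smul, one_smul] at h1 h2 h3
    rw [Pi.add_apply, h1, h3, h2]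
    split_ifs <;> simp
  map_smul' a c := by
    ext i
    have h1 := codeFormSq_add_smul m a c 0
    have h2 := shadowFormFourth_add_smul m a (shadowCoeff m c) 0
    have h3 := shadowCoeff_add_smul m a c 0
    have e1 : codeFormSq m (0 : Fin (3 * m + 1) → ℚ) = 0 := by simp [codeFormSq]
    have e2 : shadowFormFourth m (0 : Fin (3 * m + 1) → ℚ) = 0 := by simp [shadowFormFourth]
    have e3 : shadowCoeff m 0 = 0 := by ext j; simp [shadowCoeff]
    rw [add_zero, e1, add_zero] at h1
    rw [add_zero, e2, add_zero] at h2
    rw [add_zero, e3, add_zero] at h3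
    rw [Pi.smul_apply, h1, h3, h2]
    split_ifs <;> simp

/-- The two inversions meet without gap or overlap: J ≤ 2m needs only a_0, …, a_J, and J > 2m needs
only b_i with i ≤ 3m-J ≤ m-1. -/
theorem conditionMap_injective (m : ℕ) : Function.Injective (conditionMap m) := by
  rw [← LinearMap.ker_eq_bot, LinearMap.ker_eq_bot']
  intro c hc
  ext J
  have key : ∀ i : Fin (3 * m + 1), (if (i : ℕ) ≤ 2 * m then (codeFormSq m c).coeff i
    else (shadowFormFourth m (shadowCoeff m c)).coeff (3 * m - i)) = 0 := fun i => congrFun hc i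
  by_cases hJ : (J : ℕ) ≤ 2 * m
  · refine eq_zero_of_coeff_codeFormSq J fun i hi => ?_
    have := key ⟨i, by omega⟩
    rwa [if_pos (show i ≤ 2 * m by omega)] at this
  · refine shadowCoeff_eq_zero_iff.mp (eq_zero_of_coeff_shadowFormFourth J fun i hi => ?_)
    have := key ⟨3 * m - i, by omega⟩
    rw [if_neg (show ¬ 3 * m - i ≤ 2 * m by omega)] at this
    rwa [show 3 * m - (3 * m - i) = i by omega] at this

theorem isAdmissible_iff_conditionMap {m : ℕ} (hm : 1 ≤ m) {c : Fin (3 * m + 1) → ℚ} :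
    IsAdmissible m c ↔ conditionMap m c =
      fun i : Fin (3 * m + 1) => if (i : ℕ) = 0 ∨ (i : ℕ) = 3 * m then (1 : ℚ) else 0 := by
  rw [isAdmissible_iff, funext_iff]
  change _ ↔ ∀ i : Fin (3 * m + 1), (if (i : ℕ) ≤ 2 * m then (codeFormSq m c).coeff i
    else (shadowFormFourth m (shadowCoeff m c)).coeff (3 * m - i)) = _
  constructor
  · rintro ⟨h1, h2, h3, h4⟩ ⟨i, hi⟩
    dsimp only
    by_cases hi2 : i ≤ 2 * m
    · rw [if_pos hi2]
      rcases Nat.eq_zero_or_pos i with rfl | h0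
      · simpa using h1
      · rw [if_neg (by omega), h2 i h0 hi2]
    · rw [if_neg hi2]
      rcases Nat.eq_zero_or_pos (3 * m - i) with h0 | h0
      · rw [if_pos (by omega), h0, h3]
      · rw [if_neg (by omega), h4 _ h0 (by omega)]
  · intro h
    refine ⟨?_, fun i h1 h2 => ?_, ?_, fun i h1 h2 => ?_⟩
    · simpa using h ⟨0, by omega⟩
    · have := h ⟨i, by omega⟩
      dsimp only at this
      rwa [if_pos h2, if_neg (by omega)] at this
    · have := h ⟨3 * m, by omega⟩
      dsimp only at this
      rwa [if_neg (by omega), if_pos (by omega), Nat.sub_self] at this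
    · have := h ⟨3 * m - i, by omega⟩
      dsimp only at this
      rwa [if_neg (by omega), if_neg (by omega), show 3 * m - (3 * m - i) = i by omega] at this

theorem existsUnique_isAdmissible {m : ℕ} (hm : 1 ≤ m) :
    ∃! c : Fin (3 * m + 1) → ℚ, IsAdmissible m c := by
  simp only [isAdmissible_iff_conditionMap hm]
  exact Function.Bijective.existsUnique ⟨conditionMap_injective m,
    LinearMap.injective_iff_surjective.mp (conditionMap_injective m)⟩ _

/-! ### The MacWilliams identity -/

theorem zmod_two_eq_zero_or_one (t : ZMod 2) : t = 0 ∨ t = 1 := by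
  revert t
  decide

/-- The nontrivial character of `𝔽₂`. -/
def sgn (t : ZMod 2) : ℚ := if t = 0 then 1 else -1

theorem sgn_zero : sgn 0 = 1 := rfl

theorem sgn_one : sgn 1 = -1 := rfl

theorem sgn_add (s t : ZMod 2) : sgn (s + t) = sgn s * sgn t := by
  have h : (1 + 1 : ZMod 2) = 0 := rfl
  rcases zmod_two_eq_zero_or_one s with rfl | rfl <;>
    rcases zmod_two_eq_zero_or_one t with rfl | rfl <;> simp [sgn, h]

theorem sgn_sum {ι : Type*} (s : Finset ι) (f : ι → ZMod 2) :
    sgn (∑ i ∈ s, f i) = ∏ i ∈ s, sgn (f i) := by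
  classical
  induction s using Finset.induction_on with
  | empty => rfl
  | insert a s ha ih => rw [Finset.sum_insert ha, Finset.prod_insert ha, sgn_add, ih]

theorem prod_ite_eq_zero {n : ℕ} (x : Fin n → ZMod 2) (a b : ℚ) :
    ∏ i, (if x i = 0 then a else b) = a ^ (n - hammingNorm x) * b ^ hammingNorm x := by
  rw [Finset.prod_ite, Finset.prod_const, Finset.prod_const]
  congr 2
  have h := Finset.card_filter_add_card_filter_not (s := Finset.univ) (fun i => x i = 0)
  rw [Finset.card_univ, Fintype.card_fin] at h
  have : hammingNorm x = (Finset.univ.filter fun i => ¬ x i = 0).card := rfl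
  omega

/-- Both the character and the weight factor over coordinates, so this Fourier transform is a
product of transforms on `ZMod 2`. -/
theorem sum_sgn_dotProduct {n : ℕ} (c : Fin n → ZMod 2) (a b : ℚ) :
    ∑ x : Fin n → ZMod 2, sgn (x ⬝ᵥ c) * ∏ i, (if x i = 0 then a else b) =
      ∏ i, (if c i = 0 then a + b else a - b) := by
  have h (i : Fin n) : (if c i = 0 then a + b else a - b) =
      ∑ t : ZMod 2, sgn (t * c i) * (if t = 0 then a else b) := by
    have e : (Finset.univ : Finset (ZMod 2)) = {0, 1} := rfl
    rw [e, Finset.sum_pair (by decide)]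
    rcases zmod_two_eq_zero_or_one (c i) with h | h <;> rw [h] <;>
      simp [sgn_zero, sgn_one, sub_eq_add_neg]
  simp only [h]
  rw [Finset.prod_univ_sum, Fintype.piFinset_univ]
  refine Finset.sum_congr rfl fun x _ => ?_
  rw [Finset.prod_mul_distrib, dotProduct, sgn_sum]

-- Orthogonality of characters: if some y in D has x · y = 1, translating the sum by y changes its
-- sign.
open Classical in
theorem sum_sgn_code {n : ℕ} (D : Code n) (x : Fin n → ZMod 2) :
    ∑ c : D, sgn (x ⬝ᵥ c) =
      if x ∈ dual (D : Set (Fin n → ZMod 2)) then (Fintype.card D : ℚ) else 0 := by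
  split_ifs with hx
  · have h : ∀ c : D, sgn (x ⬝ᵥ c) = 1 := fun c => by rw [hx c c.2]; rfl
    simp [h]
  · obtain ⟨y, hy, hxy⟩ : ∃ y ∈ D, x ⬝ᵥ y ≠ 0 := by
      by_contra! hcon
      exact hx fun y hy => hcon y hy
    have h1 : x ⬝ᵥ y = 1 := by
      revert hxy
      generalize x ⬝ᵥ y = t
      revert t
      decide
    have h2 := Fintype.sum_equiv (Equiv.addRight (⟨y, hy⟩ : D)) (fun c : D => sgn (x ⬝ᵥ (c + y)))
      (fun c : D => sgn (x ⬝ᵥ c)) fun c => rfl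
    simp only [dotProduct_add, sgn_add, h1, sgn_one, mul_neg, mul_one, Finset.sum_neg_distrib] at h2
    linarith

open Classical in
/-- The MacWilliams identity. -/
theorem macWilliams {n : ℕ} (D : Code n) (a b : ℚ) :
    (Fintype.card D : ℚ) * ∑ x : dual (D : Set (Fin n → ZMod 2)),
      a ^ (n - hammingNorm (x : Fin n → ZMod 2)) * b ^ hammingNorm (x : Fin n → ZMod 2) =
    ∑ c : D, (a + b) ^ (n - hammingNorm (c : Fin n → ZMod 2)) *
      (a - b) ^ hammingNorm (c : Fin n → ZMod 2) := by
  -- Poisson summation: replace each summand by its Fourier expansion over all x and exchange the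
  -- sums.
  have h1 : ∑ c : D, (a + b) ^ (n - hammingNorm (c : Fin n → ZMod 2)) *
      (a - b) ^ hammingNorm (c : Fin n → ZMod 2) =
      ∑ x : Fin n → ZMod 2, (∏ i, (if x i = 0 then a else b)) * ∑ c : D, sgn (x ⬝ᵥ c) := by
    simp only [← prod_ite_eq_zero, ← sum_sgn_dotProduct, Finset.mul_sum]
    rw [Finset.sum_comm]
    refine Finset.sum_congr rfl fun x _ => Finset.sum_congr rfl fun c _ => mul_comm _ _
  rw [h1]
  simp only [sum_sgn_code, mul_ite, mul_zero]
  rw [← Finset.sum_filter, Finset.mul_sum,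
    ← Finset.sum_subtype (p := fun x => x ∈ dual (D : Set (Fin n → ZMod 2)))
      (Finset.univ.filter fun x => x ∈ dual (D : Set (Fin n → ZMod 2))) (by simp)
      (fun x => (Fintype.card D : ℚ) * (a ^ (n - hammingNorm x) * b ^ hammingNorm x))]
  refine Finset.sum_congr rfl fun x _ => ?_
  rw [prod_ite_eq_zero, mul_comm]

/-! ### Weights in a self-dual code -/

theorem natCast_hammingNorm {n : ℕ} (x : Fin n → ZMod 2) : (hammingNorm x : ZMod 2) = x ⬝ᵥ x := by
  rw [hammingNorm, Finset.card_filter, Nat.cast_sum, dotProduct]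
  refine Finset.sum_congr rfl fun i _ => ?_
  generalize x i = t
  revert t
  decide

/-- The number of common nonzero coordinates. -/
def overlap {n : ℕ} (x y : Fin n → ZMod 2) : ℕ :=
  (Finset.univ.filter fun i => x i ≠ 0 ∧ y i ≠ 0).card

theorem natCast_overlap {n : ℕ} (x y : Fin n → ZMod 2) : (overlap x y : ZMod 2) = x ⬝ᵥ y := by
  rw [overlap, Finset.card_filter, Nat.cast_sum, dotProduct]
  refine Finset.sum_congr rfl fun i _ => ?_
  generalize x i = s
  generalize y i = t
  revert s t
  decide

theorem hammingNorm_add {n : ℕ} (x y : Fin n → ZMod 2) :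
    hammingNorm (x + y) + 2 * overlap x y = hammingNorm x + hammingNorm y := by
  simp only [hammingNorm, overlap, Finset.card_filter, Finset.mul_sum, ← Finset.sum_add_distrib]
  refine Finset.sum_congr rfl fun i _ => ?_
  rw [Pi.add_apply]
  have h : (1 + 1 : ZMod 2) = 0 := rfl
  rcases zmod_two_eq_zero_or_one (x i) with h1 | h1 <;>
    rcases zmod_two_eq_zero_or_one (y i) with h2 | h2 <;> simp [h1, h2, h]

theorem IsSelfDual.mem_iff {n : ℕ} {C : Code n} (hC : IsSelfDual C) {x : Fin n → ZMod 2} :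
    x ∈ C ↔ ∀ y ∈ C, x ⬝ᵥ y = 0 := by
  conv_lhs => rw [hC]
  rfl

theorem even_of_natCast_eq_zero {k : ℕ} (h : (k : ZMod 2) = 0) : 2 ∣ k :=
  (ZMod.natCast_eq_zero_iff k 2).mp h

theorem IsSelfDual.two_dvd_hammingNorm {n : ℕ} {C : Code n} (hC : IsSelfDual C)
    {x : Fin n → ZMod 2} (hx : x ∈ C) : 2 ∣ hammingNorm x :=
  even_of_natCast_eq_zero (by rw [natCast_hammingNorm]; exact hC.mem_iff.mp hx x hx)

theorem IsSelfDual.two_dvd_overlap {n : ℕ} {C : Code n} (hC : IsSelfDual C)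
    {x y : Fin n → ZMod 2} (hx : x ∈ C) (hy : y ∈ C) : 2 ∣ overlap x y :=
  even_of_natCast_eq_zero (by rw [natCast_overlap]; exact hC.mem_iff.mp hx y hy)

/-- The doubly even subcode. -/
def IsSelfDual.doublyEvenCode {n : ℕ} {C : Code n} (hC : IsSelfDual C) : Code n where
  carrier := doublyEvenPart C
  add_mem' := by
    rintro x y ⟨hx, hx4⟩ ⟨hy, hy4⟩
    have h1 := hammingNorm_add x y
    have h2 := hC.two_dvd_overlap hx hy
    exact ⟨C.add_mem hx hy, by omega⟩
  zero_mem' := ⟨C.zero_mem, by simp⟩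
  smul_mem' := by
    rintro c x ⟨hx, hx4⟩
    refine ⟨C.smul_mem c hx, ?_⟩
    rcases zmod_two_eq_zero_or_one c with rfl | rfl
    · simp
    · simpa using hx4

/-- Overlaps of codewords are even, so wt/2 is additive modulo 2 on C. This character of C has
kernel C₀. -/
theorem neg_one_pow_half_add {n : ℕ} {C : Code n} (hC : IsSelfDual C)
    {x y : Fin n → ZMod 2} (hx : x ∈ C) (hy : y ∈ C) :
    (-1 : ℚ) ^ (hammingNorm (x + y) / 2) =
      (-1) ^ (hammingNorm x / 2) * (-1) ^ (hammingNorm y / 2) := by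
  have h1 := hammingNorm_add x y
  obtain ⟨k, hk⟩ := hC.two_dvd_overlap hx hy
  have h2 := hC.two_dvd_hammingNorm hx
  have h3 := hC.two_dvd_hammingNorm hy
  have h4 : hammingNorm x / 2 + hammingNorm y / 2 = hammingNorm (x + y) / 2 + 2 * k := by omega
  rw [← pow_add, h4, pow_add, pow_mul]
  simp

theorem neg_one_pow_half {w : ℕ} (hw : 2 ∣ w) :
    (-1 : ℚ) ^ (w / 2) = if 4 ∣ w then 1 else -1 := by
  split_ifs with h
  · exact Even.neg_one_pow (by rw [Nat.even_iff]; omega)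
  · exact Odd.neg_one_pow (by rw [Nat.odd_iff]; omega)

open Classical in
theorem sum_doublyEvenCode {n : ℕ} {C : Code n} (hC : IsSelfDual C)
    (f : (Fin n → ZMod 2) → ℚ) :
    ∑ x : hC.doublyEvenCode, f x =
      2⁻¹ * (∑ x : C, f x + ∑ x : C, (-1) ^ (hammingNorm (x : Fin n → ZMod 2) / 2) * f x) := by
  have h1 : ∑ x : hC.doublyEvenCode, f x =
      ∑ x : C, if 4 ∣ hammingNorm (x : Fin n → ZMod 2) then f x else 0 := by
    rw [← Finset.sum_subtype (p := fun x => x ∈ hC.doublyEvenCode)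
      (Finset.univ.filter fun x => x ∈ hC.doublyEvenCode) (by simp) f,
      ← Finset.sum_subtype (p := fun x => x ∈ C) (Finset.univ.filter fun x => x ∈ C) (by simp)
      (fun x => if 4 ∣ hammingNorm x then f x else 0), ← Finset.sum_filter, Finset.filter_filter]
    refine Finset.sum_congr ?_ fun _ _ => rfl
    ext x
    rw [Finset.mem_filter, Finset.mem_filter]
    rfl
  rw [h1, ← Finset.sum_add_distrib, Finset.mul_sum]
  refine Finset.sum_congr rfl fun x _ => ?_
  rw [neg_one_pow_half (hC.two_dvd_hammingNorm x.2)]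
  split_ifs <;> ring

open Classical in
theorem IsSinglyEvenSelfDual.sum_neg_one_pow {n : ℕ} {C : Code n} (hC : IsSinglyEvenSelfDual C) :
    ∑ x : C, (-1 : ℚ) ^ (hammingNorm (x : Fin n → ZMod 2) / 2) = 0 := by
  obtain ⟨hsd, y, hy, hy2⟩ := hC
  have h2 := Fintype.sum_equiv (Equiv.addRight (⟨y, hy⟩ : C))
    (fun c : C => (-1 : ℚ) ^ (hammingNorm ((c : Fin n → ZMod 2) + y) / 2))
    (fun c : C => (-1 : ℚ) ^ (hammingNorm (c : Fin n → ZMod 2) / 2)) fun c => rfl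
  have h3 : (-1 : ℚ) ^ (hammingNorm y / 2) = -1 := Odd.neg_one_pow (by rw [Nat.odd_iff]; omega)
  simp only [neg_one_pow_half_add hsd (Subtype.property _) hy, h3, mul_neg, mul_one,
    Finset.sum_neg_distrib] at h2
  linarith

open Classical in
theorem IsSinglyEvenSelfDual.card_doublyEvenCode {n : ℕ} {C : Code n}
    (hC : IsSinglyEvenSelfDual C) :
    (Fintype.card hC.1.doublyEvenCode : ℚ) = 2⁻¹ * Fintype.card C := by
  have := sum_doublyEvenCode hC.1 fun _ => 1
  simp only [Finset.sum_const, Finset.card_univ, nsmul_eq_mul, mul_one,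
    hC.sum_neg_one_pow, add_zero] at this
  exact this

theorem mem_dual_doublyEvenPart {n : ℕ} {C : Code n} (hC : IsSelfDual C) {x : Fin n → ZMod 2}
    (hx : x ∈ C) : x ∈ dual (doublyEvenPart C) :=
  fun y hy => hC.mem_iff.mp hx y hy.1

/-- The sum of two vectors of the shadow is a codeword. -/
theorem IsSinglyEvenSelfDual.add_mem_of_mem_shadow {n : ℕ} {C : Code n}
    (hC : IsSinglyEvenSelfDual C) {u v : Fin n → ZMod 2} (hu : u ∈ shadow C) (hv : v ∈ shadow C) :
    u + v ∈ C := by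
  obtain ⟨hsd, y, hy, hy2⟩ := hC
  -- For x in C outside C₀ the word x + y lies in C₀. Hence a vector of C₀^⊥ orthogonal to the
  -- single word y is orthogonal to all of C; shadow vectors pair to 1 with y, and the sum of two of
  -- them pairs to 0.
  have key {u : Fin n → ZMod 2} (hu : u ∈ dual (doublyEvenPart C)) {x : Fin n → ZMod 2}
      (hx : x ∈ C) (h : u ⬝ᵥ y = 0) : u ⬝ᵥ x = 0 := by
    have h1 := hsd.two_dvd_hammingNorm hx
    by_cases h4 : 4 ∣ hammingNorm x
    · exact hu x ⟨hx, h4⟩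
    · have h2 := hammingNorm_add x y
      have h3 := hsd.two_dvd_overlap hx hy
      have := hu (x + y) ⟨C.add_mem hx hy, by omega⟩
      rwa [dotProduct_add, h, add_zero] at this
  have one {u : Fin n → ZMod 2} (hu : u ∈ shadow C) : u ⬝ᵥ y = 1 := by
    by_contra h
    have h0 : u ⬝ᵥ y = 0 := by
      revert h
      generalize u ⬝ᵥ y = t
      revert t
      decide
    exact hu.2 (hsd.mem_iff.mpr fun x hx => key hu.1 hx h0)
  refine hsd.mem_iff.mpr fun x hx => key (Submodule.add_mem _ hu.1 hv.1) hx ?_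
  rw [add_dotProduct, one hu, one hv]
  rfl

/-! ### Weight enumerators -/

open Classical in
theorem eval_weightEnumerator {n : ℕ} (S : Set (Fin n → ZMod 2)) (y : ℚ) :
    (weightEnumerator S).eval y = ∑ x : Fin n → ZMod 2 with x ∈ S, y ^ hammingNorm x := by
  simp [weightEnumerator, eval_finsetSum]

open Classical in
theorem coeff_weightEnumerator {n : ℕ} (S : Set (Fin n → ZMod 2)) (k : ℕ) :
    (weightEnumerator S).coeff k =
      ((Finset.univ.filter fun x : Fin n → ZMod 2 => x ∈ S ∧ hammingNorm x = k).card : ℚ) := by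
  rw [weightEnumerator, finsetSum_coeff]
  simp only [coeff_X_pow, eq_comm (a := k)]
  rw [Finset.sum_boole, Finset.filter_filter]

theorem coeff_weightEnumerator_nonneg {n : ℕ} (S : Set (Fin n → ZMod 2)) (k : ℕ) :
    0 ≤ (weightEnumerator S).coeff k := by
  rw [coeff_weightEnumerator]; positivity

theorem natDegree_weightEnumerator_le {n : ℕ} (S : Set (Fin n → ZMod 2)) :
    (weightEnumerator S).natDegree ≤ n :=
  natDegree_sum_le_of_forall_le _ _ fun x _ => (natDegree_X_pow_le _).trans
    (by simpa using hammingNorm_le_card_fintype (x := x))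

theorem coeff_weightEnumerator_eq_zero {n : ℕ} {S : Set (Fin n → ZMod 2)} {k : ℕ}
    (h : ∀ x ∈ S, hammingNorm x ≠ k) : (weightEnumerator S).coeff k = 0 := by
  classical
  rw [coeff_weightEnumerator, Nat.cast_eq_zero, Finset.card_eq_zero,
    Finset.filter_eq_empty_iff]
  exact fun x _ hx => h x hx.1 hx.2

theorem coeff_weightEnumerator_eq_one {n : ℕ} {S : Set (Fin n → ZMod 2)} {k : ℕ}
    {x : Fin n → ZMod 2} (hx : x ∈ S) (hk : hammingNorm x = k)
    (h : ∀ y ∈ S, hammingNorm y = k → y = x) : (weightEnumerator S).coeff k = 1 := by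
  classical
  rw [coeff_weightEnumerator, Nat.cast_eq_one, Finset.card_eq_one]
  refine ⟨x, ?_⟩
  ext y
  simp only [Finset.mem_filter, Finset.mem_univ, true_and, Finset.mem_singleton]
  exact ⟨fun hy => h y hy.1 hy.2, fun hy => hy ▸ ⟨hx, hk⟩⟩

open Classical in
theorem eval_weightEnumerator_code {n : ℕ} (C : Code n) (y : ℚ) :
    (weightEnumerator (C : Set (Fin n → ZMod 2))).eval y =
      ∑ x : C, y ^ hammingNorm (x : Fin n → ZMod 2) := by
  rw [eval_weightEnumerator]
  exact Finset.sum_subtype (p := fun x => x ∈ C) _ (by simp) (fun x => y ^ hammingNorm x)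

theorem pow_sub_mul_pow_eq {n w : ℕ} (hw : w ≤ n) {y : ℚ} (hy : 1 + y ≠ 0) :
    (1 + y) ^ (n - w) * (1 - y) ^ w = (1 + y) ^ n * ((1 - y) / (1 + y)) ^ w := by
  obtain ⟨k, rfl⟩ := Nat.exists_eq_add_of_le' hw
  rw [Nat.add_sub_cancel, pow_add, div_pow]
  field_simp

theorem hammingNorm_le {n : ℕ} (x : Fin n → ZMod 2) : hammingNorm x ≤ n := by
  simpa using hammingNorm_le_card_fintype (x := x)

open Classical in
theorem IsSelfDual.card_mul_eval_weightEnumerator {n : ℕ} {C : Code n} (hC : IsSelfDual C)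
    {y : ℚ} (hy : 1 + y ≠ 0) :
    (Fintype.card C : ℚ) * (weightEnumerator (C : Set (Fin n → ZMod 2))).eval y =
      (1 + y) ^ n *
        (weightEnumerator (C : Set (Fin n → ZMod 2))).eval ((1 - y) / (1 + y)) := by
  have h := macWilliams C 1 y
  simp only [one_pow, one_mul, pow_sub_mul_pow_eq (hammingNorm_le _) hy, ← Finset.mul_sum] at h
  rw [eval_weightEnumerator_code C ((1 - y) / (1 + y)), ← h, eval_weightEnumerator]
  congr 1
  refine (Finset.sum_subtype (p := fun x => x ∈ dual (C : Set (Fin n → ZMod 2))) _ (fun x => ?_)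
    (fun x => y ^ hammingNorm x))
  rw [← hC]
  simp

open Classical in
/-- The MacWilliams identity for the shadow. -/
theorem IsSinglyEvenSelfDual.card_mul_eval_weightEnumerator_shadow {n : ℕ} {C : Code n}
    (hC : IsSinglyEvenSelfDual C) {y : ℚ} (hy : 1 + y ≠ 0) :
    (Fintype.card C : ℚ) * (weightEnumerator (shadow C)).eval y =
      (1 + y) ^ n * ∑ x : C, (-1) ^ (hammingNorm (x : Fin n → ZMod 2) / 2) *
        ((1 - y) / (1 + y)) ^ hammingNorm (x : Fin n → ZMod 2) := by
  -- The dual of C₀ is the disjoint union of C and S, and |C₀| = |C|/2. Splitting the sum over C₀ by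
  -- the character (-1)^(wt/2), the trivial part is MacWilliams for C itself and cancels the
  -- contribution of C.
  have h := macWilliams hC.1.doublyEvenCode 1 y
  rw [hC.card_doublyEvenCode, sum_doublyEvenCode hC.1 fun x =>
    (1 + y) ^ (n - hammingNorm x) * (1 - y) ^ hammingNorm x] at h
  simp only [one_pow, one_mul, pow_sub_mul_pow_eq (hammingNorm_le _) hy, ← Finset.mul_sum] at h
  rw [← eval_weightEnumerator_code C ((1 - y) / (1 + y)),
    ← hC.1.card_mul_eval_weightEnumerator hy] at h
  have h2 : ∑ x : dual (hC.1.doublyEvenCode : Set (Fin n → ZMod 2)),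
      y ^ hammingNorm (x : Fin n → ZMod 2) =
      (weightEnumerator (C : Set (Fin n → ZMod 2))).eval y +
        (weightEnumerator (shadow C)).eval y := by
    rw [eval_weightEnumerator, eval_weightEnumerator, ← Finset.sum_union]
    · refine (Finset.sum_subtype (p := fun x =>
        x ∈ dual (hC.1.doublyEvenCode : Set (Fin n → ZMod 2))) _ (fun x => ?_)
          (fun x => y ^ hammingNorm x)).symm
      simp only [Finset.mem_union, Finset.mem_filter, Finset.mem_univ, true_and, SetLike.mem_coe]
      constructor
      · rintro (hx | hx)
        · exact mem_dual_doublyEvenPart hC.1 hx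
        · exact hx.1
      · intro hx
        by_cases hxC : x ∈ C
        · exact Or.inl hxC
        · exact Or.inr ⟨hx, hxC⟩
    · rw [Finset.disjoint_filter]
      exact fun x _ hx hx' => hx'.2 hx
  rw [h2] at h
  have h3 (x : C) : (-1 : ℚ) ^ (hammingNorm (x : Fin n → ZMod 2) / 2) *
      ((1 + y) ^ n * ((1 - y) / (1 + y)) ^ hammingNorm (x : Fin n → ZMod 2)) =
      (1 + y) ^ n * ((-1) ^ (hammingNorm (x : Fin n → ZMod 2) / 2) *
        ((1 - y) / (1 + y)) ^ hammingNorm (x : Fin n → ZMod 2)) := by ring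
  simp only [h3, ← Finset.mul_sum] at h
  linarith

/-! ### The coefficient `a_{2m+4}` -/

/-- The power series with the given initial coefficients and no others. -/
def listSeries : List ℚ → PowerSeries ℚ
  | [] => 0
  | a :: l => PowerSeries.C a + PowerSeries.X * listSeries l

theorem coeff_listSeries_mul (l : List ℚ) (G : PowerSeries ℚ) (n : ℕ) (h : l.length ≤ n + 1) :
    PowerSeries.coeff n (listSeries l * G) =
      ∑ k ∈ Finset.range l.length, l.getD k 0 * PowerSeries.coeff (n - k) G := by
  induction l generalizing n with
  | nil => simp [listSeries]
  | cons a l ih =>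
    rw [List.length_cons, Finset.sum_range_succ', listSeries, add_mul, map_add,
      PowerSeries.coeff_C_mul, mul_assoc, add_comm]
    congr 1
    rcases l with - | ⟨b, l⟩
    · simp [listSeries]
    · obtain ⟨n, rfl⟩ : ∃ k, n = k + 1 := ⟨n - 1, by simp at h; omega⟩
      rw [PowerSeries.coeff_succ_X_mul, ih n (by simp at h ⊢; omega)]
      refine Finset.sum_congr rfl fun k _ => ?_
      rw [List.getD_cons_succ, Nat.add_sub_add_right]

/-- With a numerator split as E(X²) + X O(X²) and a second factor in X², the parity of the index
selects one half. -/
theorem coeff_even_expand (E O G : PowerSeries ℚ) (n : ℕ) :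
    PowerSeries.coeff (2 * n) ((PowerSeries.expand 2 two_ne_zero E +
      PowerSeries.X * PowerSeries.expand 2 two_ne_zero O) *
        PowerSeries.expand 2 two_ne_zero G) = PowerSeries.coeff n (E * G) := by
  rw [add_mul, ← map_mul, mul_assoc, ← map_mul, map_add, PowerSeries.coeff_expand_mul]
  rcases n with - | n
  · simp
  · rw [show 2 * (n + 1) = 2 * n + 1 + 1 by ring, PowerSeries.coeff_succ_X_mul,
      PowerSeries.coeff_expand_of_not_dvd _ _ _ (by omega), add_zero]

theorem coeff_odd_expand (E O G : PowerSeries ℚ) (n : ℕ) :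
    PowerSeries.coeff (2 * n + 1) ((PowerSeries.expand 2 two_ne_zero E +
      PowerSeries.X * PowerSeries.expand 2 two_ne_zero O) *
        PowerSeries.expand 2 two_ne_zero G) = PowerSeries.coeff n (O * G) := by
  rw [add_mul, ← map_mul, mul_assoc, ← map_mul, map_add, PowerSeries.coeff_succ_X_mul,
    PowerSeries.coeff_expand_mul, PowerSeries.coeff_expand_of_not_dvd _ _ _ (by omega), zero_add]

theorem expand_geom : PowerSeries.expand 2 two_ne_zero geom = altGeom * geom := by
  have h := congrArg (PowerSeries.expand 2 two_ne_zero) one_sub_mul_geom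
  simp only [map_mul, map_sub, map_one, PowerSeries.expand_X] at h
  have hg := one_sub_mul_geom
  have ha := one_add_mul_altGeom
  linear_combination altGeom * geom * h - PowerSeries.expand 2 two_ne_zero geom *
    ((1 + PowerSeries.X) * altGeom * hg + ha)

/-- The numerator of `codeKernel m (2 * m + i)`. -/
def kernelNumerator (i : ℕ) : PowerSeries ℚ :=
  (1 + PowerSeries.X) ^ (6 * i - 1) * (1 - 6 * PowerSeries.X + PowerSeries.X ^ 2)

/-- Trading 1/(1-X) for (1+X)/(1-X²) leaves only the fixed power (1+X)^(6i-1). Thus m enters only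
through the exponent of 1/(1-X²), and each coefficient is a sum of boundedly many binomials. -/
theorem codeKernel_eq {m i : ℕ} (hi : 1 ≤ i) (h : 2 * i ≤ 8 * m) :
    codeKernel m (2 * m + i) = kernelNumerator i *
      PowerSeries.expand 2 two_ne_zero (geom ^ (4 * m + 2 * i + 1)) := by
  rw [map_pow, expand_geom, codeKernel, kernelNumerator]
  obtain ⟨r, hr⟩ : ∃ r, 8 * m + 1 = 2 * i + r := ⟨8 * m + 1 - 2 * i, by omega⟩
  have e1 : (((1 + PowerSeries.X) ^ 4 * geom ^ 2) ^ (2 * m + i) : PowerSeries ℚ) =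
      (1 + PowerSeries.X) ^ (6 * i - 1 + r) * geom ^ (4 * m + 2 * i) := by
    rw [mul_pow, ← pow_mul, ← pow_mul]
    congr 2 <;> omega
  have e2 : altGeom ^ (12 * m + 1) = altGeom ^ r * altGeom ^ (4 * m + 2 * i) := by
    rw [← pow_add]; congr 1; omega
  have e3 : ((1 + PowerSeries.X) * altGeom) ^ r = 1 := by rw [one_add_mul_altGeom, one_pow]
  rw [e1, e2]
  calc _ = ((1 + PowerSeries.X) * altGeom) ^ r * ((1 + PowerSeries.X) ^ (6 * i - 1) *
        (1 - 6 * PowerSeries.X + PowerSeries.X ^ 2) *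
          (altGeom * geom) ^ (4 * m + 2 * i + 1)) := by
        generalize (1 + PowerSeries.X : PowerSeries ℚ) = p
        simp only [mul_pow]
        ring
    _ = _ := by rw [e3, one_mul]

theorem kernelNumerator_one : kernelNumerator 1 =
    PowerSeries.expand 2 two_ne_zero (listSeries [1, -19, -45, -1]) +
      PowerSeries.X * PowerSeries.expand 2 two_ne_zero (listSeries [-1, -45, -19, 1]) := by
  simp [kernelNumerator, listSeries, map_ofNat]; ring

theorem kernelNumerator_two : kernelNumerator 2 =
    PowerSeries.expand 2 two_ne_zero (listSeries [1, -10, -605, -1980, -1353, -154, 5]) +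
      PowerSeries.X * PowerSeries.expand 2 two_ne_zero
        (listSeries [5, -154, -1353, -1980, -605, -10, 1]) := by
  simp [kernelNumerator, listSeries, map_ofNat]; ring

theorem kernelNumerator_three : kernelNumerator 3 =
    PowerSeries.expand 2 two_ne_zero
      (listSeries [1, 35, -1564, -22372, -80002, -102102, -48620, -7412, -119, 11]) +
      PowerSeries.X * PowerSeries.expand 2 two_ne_zero
        (listSeries [11, -119, -7412, -48620, -102102, -80002, -22372, -1564, 35, 1]) := by
  simp [kernelNumerator, listSeries, map_ofNat]; ring

theorem kernelNumerator_four : kernelNumerator 4 =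
    PowerSeries.expand 2 two_ne_zero
      (listSeries [1, 116, -1518, -92092, -879681, -3268760, -5616324, -4695128, -1879537,
        -326876, -17710, 276, 17]) +
      PowerSeries.X * PowerSeries.expand 2 two_ne_zero
        (listSeries [17, 276, -17710, -326876, -1879537, -4695128, -5616324, -3268760, -879681,
          -92092, -1518, 116, 1]) := by
  simp [kernelNumerator, listSeries, map_ofNat]; ring

/-- A common denominator of all terms of `a_{2m+1}, …, a_{2m+4}`. -/
def leadRatio (m : ℕ) : ℚ :=
  ((5 * m - 2).factorial : ℚ) / ((4 * m + 8).factorial * (m + 2).factorial)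

theorem leadRatio_pos (m : ℕ) : 0 < leadRatio m := by
  unfold leadRatio; positivity

/-- The condition t + s = a + 4 says that the lower complement of the binomial is m + 2 - s; the
three products are the quotients of its factorials by those in `leadRatio`. -/
theorem choose_eq_leadRatio_mul {m t a s : ℕ} (ha : a ≤ 8) (hs : t + s = a + 4) (hm : s ≤ m + 2)
    (hm' : 1 ≤ m) :
    ((5 * m - 2 + t).choose (4 * m + a) : ℚ) = leadRatio m *
      ((∏ l ∈ Finset.range t, (5 * m - 1 + l : ℚ)) *
        (∏ l ∈ Finset.range (8 - a), (4 * m + a + 1 + l : ℚ)) *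
        ∏ l ∈ Finset.range s, (m + 2 - l : ℚ)) := by
  have h1 := Nat.factorial_mul_ascFactorial (5 * m - 2) t
  have h2 := Nat.factorial_mul_ascFactorial (4 * m + a) (8 - a)
  have h3 := Nat.factorial_mul_descFactorial hm
  have h4 := Nat.choose_mul_factorial_mul_factorial (show 4 * m + a ≤ 5 * m - 2 + t by omega)
  rw [show 5 * m - 2 + t - (4 * m + a) = m + 2 - s by omega] at h4
  rw [show 4 * m + a + (8 - a) = 4 * m + 8 by omega] at h2
  rw [Nat.ascFactorial_eq_prod_range] at h1 h2
  rw [Nat.descFactorial_eq_prod_range] at h3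
  have p1 : ((∏ l ∈ Finset.range t, (5 * m - 2 + 1 + l) : ℕ) : ℚ) =
      ∏ l ∈ Finset.range t, (5 * m - 1 + l : ℚ) := by
    rw [Nat.cast_prod]
    refine Finset.prod_congr rfl fun l _ => ?_
    rw [show 5 * m - 2 + 1 + l = 5 * m + l - 1 by omega, Nat.cast_sub (by omega)]
    push_cast; ring
  have p3 : ((∏ l ∈ Finset.range s, (m + 2 - l) : ℕ) : ℚ) =
      ∏ l ∈ Finset.range s, (m + 2 - l : ℚ) := by
    rw [Nat.cast_prod]
    refine Finset.prod_congr rfl fun l hl => ?_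
    rw [Finset.mem_range] at hl
    rw [Nat.cast_sub (by omega)]
    push_cast; ring
  have p2 : ((∏ l ∈ Finset.range (8 - a), (4 * m + a + 1 + l) : ℕ) : ℚ) =
      ∏ l ∈ Finset.range (8 - a), (4 * m + a + 1 + l : ℚ) := by
    push_cast; rfl
  rw [← p1, ← p2, ← p3, leadRatio, ← h2, ← h3, div_mul_eq_mul_div]
  set P1 := ∏ l ∈ Finset.range t, (5 * m - 2 + 1 + l)
  set P2 := ∏ l ∈ Finset.range (8 - a), (4 * m + a + 1 + l)
  set P3 := ∏ l ∈ Finset.range s, (m + 2 - l)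
  have n2 : P2 ≠ 0 := fun h => by
    rw [h, mul_zero] at h2; exact (Nat.factorial_ne_zero _ h2.symm).elim
  have n3 : P3 ≠ 0 := fun h => by
    rw [h, mul_zero] at h3; exact (Nat.factorial_ne_zero _ h3.symm).elim
  have n1 := Nat.factorial_ne_zero (4 * m + a)
  have n4 := Nat.factorial_ne_zero (m + 2 - s)
  rw [eq_div_iff (by push_cast; positivity)]
  have h5 : ((5 * m - 2).factorial * P1 : ℚ) =
      (5 * m - 2 + t).choose (4 * m + a) * (4 * m + a).factorial * (m + 2 - s).factorial := by
    exact_mod_cast h1.trans h4.symm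
  push_cast
  linear_combination -(P2 * P3 : ℚ) * h5

/-- `d_{2m+i}` for an admissible `c`. -/
theorem IsAdmissible.shadowCoeff_eq {m : ℕ} {c : Fin (3 * m + 1) → ℚ} (hc : IsAdmissible m c)
    (J : Fin (3 * m + 1)) (k : ℕ) (hJ : 3 * m - (J : ℕ) = k + 1) (hk : k + 1 < m) :
    shadowCoeff m c J = (6 * m - (k + 1)).choose (6 * m - 2 * (k + 1)) +
      (6 * m - (k + 2)).choose (6 * m - 2 * (k + 1)) := by
  obtain ⟨-, -, h0, h1⟩ := isAdmissible_iff.mp hc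
  have h := coeff_shadowFormFourth_mul_shadowKernel m (shadowCoeff m c) J
  rw [hJ] at h
  set v : PowerSeries ℚ := (shadowFormFourth m (shadowCoeff m c) : PowerSeries ℚ) with hv
  -- Since k + 1 ≤ m - 1, the form is 1 up to order k + 1 inclusive, so only the kernel contributes.
  have hz : PowerSeries.coeff (k + 1) ((v - 1) * shadowKernel m (k + 1)) = 0 := by
    refine coeff_mul_eq_zero_of_forall_le (fun i hi => ?_) _
    rcases Nat.eq_zero_or_pos i with rfl | hi0
    · simp only [map_sub, hv, Polynomial.coeff_coe, h0, PowerSeries.coeff_one, if_pos, sub_self]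
    · simp only [map_sub, hv, Polynomial.coeff_coe, h1 i hi0 (by omega), PowerSeries.coeff_one,
        if_neg hi0.ne', sub_self]
  rw [sub_mul, one_mul, map_sub, h, sub_eq_zero] at hz
  rw [hz, shadowKernel]
  have e : geom ^ (6 * m) * (((1 - PowerSeries.X) ^ 2) ^ (k + 1) *
      ((1 + PowerSeries.X) * geom)) = geom ^ (6 * m - 2 * (k + 1) + 1) +
        PowerSeries.X * geom ^ (6 * m - 2 * (k + 1) + 1) := by
    have e3 : ((1 - PowerSeries.X) * geom) ^ (2 * (k + 1)) = 1 := by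
      rw [one_sub_mul_geom, one_pow]
    obtain ⟨r, hr⟩ : ∃ r, 6 * m = 2 * (k + 1) + r := ⟨6 * m - 2 * (k + 1), by omega⟩
    rw [hr, Nat.add_sub_cancel_left]
    calc _ = ((1 - PowerSeries.X) * geom) ^ (2 * (k + 1)) *
          ((1 + PowerSeries.X) * geom ^ (r + 1)) := by
          rw [← pow_mul, mul_pow]; ring
      _ = _ := by rw [e3]; ring
  rw [e, map_add, PowerSeries.coeff_succ_X_mul, coeff_geom_pow, coeff_geom_pow]
  congr 3 <;> omega

theorem coeff_mul_of_eq_one_add {f S : PowerSeries ℚ} {n : ℕ}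
    (h0 : PowerSeries.coeff 0 f = 1) (h : ∀ i, 1 ≤ i → i ≤ n → PowerSeries.coeff i f = 0)
    (r : ℕ) : PowerSeries.coeff (n + 1 + r) (f * S) = PowerSeries.coeff (n + 1 + r) S +
      ∑ l ∈ Finset.range (r + 1),
        PowerSeries.coeff (n + 1 + l) f * PowerSeries.coeff (r - l) S := by
  have hf : f = 1 + PowerSeries.X ^ (n + 1) *
      PowerSeries.mk fun l => PowerSeries.coeff (n + 1 + l) f := by
    ext i
    rw [map_add, PowerSeries.coeff_X_pow_mul', PowerSeries.coeff_one]
    rcases Nat.eq_zero_or_pos i with rfl | hi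
    · simpa using h0
    · rw [if_neg hi.ne', zero_add]
      split_ifs with h'
      · rw [PowerSeries.coeff_mk]; congr 2; omega
      · exact h i hi (by omega)
  conv_lhs => rw [hf]
  rw [add_mul, one_mul, map_add, mul_assoc, add_comm (n + 1) r, PowerSeries.coeff_X_pow_mul,
    PowerSeries.coeff_mul, Finset.Nat.sum_antidiagonal_eq_sum_range_succ_mk]
  simp

/-- The relation between `c_{2m+i}` and `a_{2m+1}, …, a_{2m+i}` for an admissible `c`. -/
theorem IsAdmissible.c_eq {m : ℕ} {c : Fin (3 * m + 1) → ℚ} (hc : IsAdmissible m c)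
    (r : ℕ) (hJ : 2 * m + 1 + r < 3 * m + 1) :
    c ⟨2 * m + 1 + r, hJ⟩ = PowerSeries.coeff (2 * m + 1 + r) (codeKernel m (2 * m + 1 + r)) +
      ∑ l ∈ Finset.range (r + 1), (codeFormSq m c).coeff (2 * m + 1 + l) *
        PowerSeries.coeff (r - l) (codeKernel m (2 * m + 1 + r)) := by
  obtain ⟨h0, h1, -, -⟩ := isAdmissible_iff.mp hc
  rw [← coeff_codeFormSq_mul_codeKernel m c ⟨2 * m + 1 + r, hJ⟩,
    coeff_mul_of_eq_one_add (by simpa using h0) (by simpa using h1)]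
  simp only [Polynomial.coeff_coe]

/-- The second expression for c_{2m+i}, coming from the shadow conditions. The power of two in
d_{2m+i} has exponent 12m + 1 - 6(2m+i) = 1 - 6i, and the sign is (-1)^i. -/
theorem IsAdmissible.c_eq' {m : ℕ} {c : Fin (3 * m + 1) → ℚ} (hc : IsAdmissible m c)
    (i k : ℕ) (hk : m = k + 1 + i) (hi : 1 ≤ i) (hJ : 2 * m + i < 3 * m + 1) :
    c ⟨2 * m + i, hJ⟩ = (-1) ^ i * 2 ^ (6 * i - 1) *
      ((5 * m + i).choose (4 * m + 2 * i) + (5 * m + i - 1).choose (4 * m + 2 * i)) := by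
  have h := hc.shadowCoeff_eq ⟨2 * m + i, hJ⟩ k (by simp only; omega) (by omega)
  rw [show 6 * m - (k + 1) = 5 * m + i by omega, show 6 * m - (k + 2) = 5 * m + i - 1 by omega,
    show 6 * m - 2 * (k + 1) = 4 * m + 2 * i by omega] at h
  rw [← h, shadowCoeff]
  simp only
  have e : (2 : ℚ) ^ (6 * i - 1) * 2 ^ (12 * (m : ℤ) + 1 - 6 * ((2 * m + i : ℕ) : ℤ)) = 1 := by
    rw [← zpow_natCast, ← zpow_add₀ (by norm_num)]
    rw [show ((6 * i - 1 : ℕ) : ℤ) + (12 * (m : ℤ) + 1 - 6 * ((2 * m + i : ℕ) : ℤ)) = 0 by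
      push_cast [Nat.cast_sub (show 1 ≤ 6 * i by omega)]; ring]
    simp
  have e2 : (-1 : ℚ) ^ i * (-1) ^ (2 * m + i) = 1 := by
    rw [← pow_add, show i + (2 * m + i) = 2 * (m + i) by ring, pow_mul]; simp
  linear_combination -(c ⟨2 * m + i, hJ⟩) * (-1 : ℚ) ^ i * (-1) ^ (2 * m + i) * e -
    (c ⟨2 * m + i, hJ⟩) * e2

theorem coeff_listSeries_mul_geom (l : List ℚ) {m a h : ℕ} (ha : a ≤ 8) (hm : 12 ≤ m)
    (hh : h ≤ 2) (hl : l.length ≤ a + h + 3) :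
    PowerSeries.coeff (m + h) (listSeries l * geom ^ (4 * m + a + 1)) = leadRatio m *
      ∑ k ∈ Finset.range l.length, l.getD k 0 *
        ((∏ l ∈ Finset.range (a + h + 2 - k), (5 * m - 1 + l : ℚ)) *
        (∏ l ∈ Finset.range (8 - a), (4 * m + a + 1 + l : ℚ)) *
        ∏ l ∈ Finset.range (2 + k - h), (m + 2 - l : ℚ)) := by
  rw [coeff_listSeries_mul _ _ _ (by omega), Finset.mul_sum]
  refine Finset.sum_congr rfl fun k hk => ?_
  rw [Finset.mem_range] at hk
  rw [coeff_geom_pow, show 4 * m + a + (m + h - k) = 5 * m - 2 + (a + h + 2 - k) by omega,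
    choose_eq_leadRatio_mul ha (s := 2 + k - h) (by omega) (by omega) (by omega)]
  ring

theorem coeff_zero_listSeries_mul_geom (a : ℚ) (l : List ℚ) (d : ℕ) :
    PowerSeries.coeff 0 (listSeries (a :: l) * geom ^ (d + 1)) = a := by
  simp [listSeries, constantCoeff_geom]

theorem coeff_one_listSeries_mul_geom (a b : ℚ) (l : List ℚ) (d : ℕ) :
    PowerSeries.coeff 1 (listSeries (a :: b :: l) * geom ^ (d + 1)) = a * (d + 1) + b := by
  rw [listSeries, add_mul, map_add, PowerSeries.coeff_C_mul, mul_assoc,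
    ← zero_add 1, PowerSeries.coeff_succ_X_mul, zero_add,
    coeff_zero_listSeries_mul_geom, coeff_geom_pow]
  simp

/-- The coefficient `a_{2m+4}` in closed form. -/
theorem IsAdmissible.coeff_codeFormSq_eq {m : ℕ} {c : Fin (3 * m + 1) → ℚ}
    (hc : IsAdmissible m c) (hm : 12 ≤ m) : (codeFormSq m c).coeff (2 * m + 4) = leadRatio m *
      ((-115200) * m ^ 2 + (1209600) * m ^ 3 + (-1411840) * m ^ 4 + (-1178261760) * m ^ 5 +
      (20379838720) * m ^ 6 + (-147623715840) * m ^ 7 + (519318543360) * m ^ 8 +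
      (-647721123840) * m ^ 9 + (-683872747520) * m ^ 10 + (1400149770240) * m ^ 11 +
      (742927892480) * m ^ 12 + (-4875878400) * m ^ 13) := by
  -- Four equations, unitriangular in a_{2m+1}, …, a_{2m+4}; `d1`, …, `d4` evaluate their left-hand
  -- sides.
  have b1 := hc.c_eq 0 (by omega)
  have b2 := hc.c_eq 1 (by omega)
  have b3 := hc.c_eq 2 (by omega)
  have b4 := hc.c_eq 3 (by omega)
  have d1 := hc.c_eq' 1 (m - 2) (by omega) (by norm_num) (by omega)
  rw [show 5 * m + 1 - 1 = 5 * m - 2 + 2 by omega, show 5 * m + 1 = 5 * m - 2 + 3 by omega,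
    choose_eq_leadRatio_mul (s := 3) (by norm_num) (by norm_num) (by omega) (by omega),
    choose_eq_leadRatio_mul (s := 4) (by norm_num) (by norm_num) (by omega) (by omega)] at d1
  have d2 := hc.c_eq' 2 (m - 3) (by omega) (by norm_num) (by omega)
  rw [show 5 * m + 2 - 1 = 5 * m - 2 + 3 by omega, show 5 * m + 2 = 5 * m - 2 + 4 by omega,
    choose_eq_leadRatio_mul (s := 4) (by norm_num) (by norm_num) (by omega) (by omega),
    choose_eq_leadRatio_mul (s := 5) (by norm_num) (by norm_num) (by omega) (by omega)] at d2
  have d3 := hc.c_eq' 3 (m - 4) (by omega) (by norm_num) (by omega)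
  rw [show 5 * m + 3 - 1 = 5 * m - 2 + 4 by omega, show 5 * m + 3 = 5 * m - 2 + 5 by omega,
    choose_eq_leadRatio_mul (s := 5) (by norm_num) (by norm_num) (by omega) (by omega),
    choose_eq_leadRatio_mul (s := 6) (by norm_num) (by norm_num) (by omega) (by omega)] at d3
  have d4 := hc.c_eq' 4 (m - 5) (by omega) (by norm_num) (by omega)
  rw [show 5 * m + 4 - 1 = 5 * m - 2 + 5 by omega, show 5 * m + 4 = 5 * m - 2 + 6 by omega,
    choose_eq_leadRatio_mul (s := 6) (by norm_num) (by norm_num) (by omega) (by omega),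
    choose_eq_leadRatio_mul (s := 7) (by norm_num) (by norm_num) (by omega) (by omega)] at d4
  simp only [add_assoc, Nat.reduceAdd] at b1 b2 b3 b4
  rw [d1] at b1
  rw [d2] at b2
  rw [d3] at b3
  rw [d4] at b4
  have o (n E O G) := coeff_odd_expand E O G n
  have e (n E O G) := coeff_even_expand E O G n
  have e0 := e 0
  have o0 := o 0
  have e1 := e 1
  have o1 := o 1
  have om := o m
  have em := e (m + 1)
  have om' := o (m + 1)
  have em' := e (m + 2)
  simp only [mul_add, mul_zero, mul_one, zero_add, add_assoc, Nat.reduceAdd, Nat.reduceMul]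
    at e0 o0 e1 o1 om em om' em'
  rw [codeKernel_eq (by norm_num) (by omega), kernelNumerator_one] at b1
  rw [codeKernel_eq (by norm_num) (by omega), kernelNumerator_two] at b2
  rw [codeKernel_eq (by norm_num) (by omega), kernelNumerator_three] at b3
  rw [codeKernel_eq (by norm_num) (by omega), kernelNumerator_four] at b4
  simp only [Finset.sum_range_succ, Finset.sum_range_zero, zero_add, Nat.sub_zero, Nat.reduceSub,
    add_zero, e0, o0, e1, o1, om, em, om', em', coeff_zero_listSeries_mul_geom,
    coeff_one_listSeries_mul_geom] at b1 b2 b3 b4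
  have k1 := coeff_listSeries_mul_geom [-1, -45, -19, 1] (m := m) (a := 2) (h := 0)
    (by norm_num) hm (by norm_num) (by simp)
  have k2 := coeff_listSeries_mul_geom [1, -10, -605, -1980, -1353, -154, 5]
    (m := m) (a := 4) (h := 1)
    (by norm_num) hm (by norm_num) (by simp)
  have k3 := coeff_listSeries_mul_geom
    [11, -119, -7412, -48620, -102102, -80002, -22372, -1564, 35, 1] (m := m) (a := 6) (h := 1)
    (by norm_num) hm (by norm_num) (by simp)
  have k4 := coeff_listSeries_mul_geom [1, 116, -1518, -92092, -879681, -3268760,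
    -5616324, -4695128, -1879537, -326876, -17710, 276, 17] (m := m) (a := 8) (h := 2)
    (by norm_num) hm (by norm_num) (by simp)
  simp only [Nat.reduceMul, add_zero] at b1 b2 b3 b4 k1 k2 k3 k4
  rw [k1] at b1
  rw [k2] at b2
  rw [k3] at b3
  rw [k4] at b4
  clear k1 k2 k3 k4 d1 d2 d3 d4 o e e0 o0 e1 o1 om em om' em' hc
  generalize leadRatio m = D at *
  simp only [List.length_cons, List.length_nil, Nat.reduceAdd, Nat.reduceSub, Finset.sum_range_succ,
    Finset.sum_range_zero, Finset.prod_range_succ, Finset.prod_range_zero, List.getD_cons_zero,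
    List.getD_cons_succ] at b1 b2 b3 b4
  push_cast at b1 b2 b3 b4
  generalize (m : ℚ) = x at *
  -- In the fourth equation a_{2m+3}, a_{2m+2}, a_{2m+1} have coefficients 17, 4m+125, 68m+429. In
  -- the third, a_{2m+2}, a_{2m+1} have 11, 4m+42, and in the second a_{2m+1} has 5. The multipliers
  -- cancel these three unknowns.
  linear_combination (25 - 20 * x) * b1 + (4 * x - 62) * b2 + 17 * b3 - b4

/-- The coefficient `a_{2m+4}` is negative for `m ≥ 155`. -/
theorem IsAdmissible.coeff_codeFormSq_neg {m : ℕ} {c : Fin (3 * m + 1) → ℚ}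
    (hc : IsAdmissible m c) (hm : 155 ≤ m) : (codeFormSq m c).coeff (2 * m + 4) < 0 := by
  rw [hc.coeff_codeFormSq_eq (by omega)]
  refine mul_neg_of_pos_of_neg (leadRatio_pos m) ?_
  obtain ⟨x, rfl⟩ := Nat.exists_eq_add_of_le hm
  rw [← neg_pos]
  have hx : (0 : ℚ) ≤ x := Nat.cast_nonneg x
  -- These are the coefficients of the negated polynomial after the substitution m = 155 + x; all
  -- are positive.
  have : (0 : ℚ) < 736255726429212960067691700986880000 * x ^ 0 + 1005770002279206010072816381888512000 * x
      ^ 1 + 75404111744274267318638982953587200 * x ^ 2 + 2644814350575444661528098409171200 *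
      x ^ 3 + 56519007593439249424904004355840 * x ^ 4 + 816994721952762745340200508160 * x ^
      5 + 8407064533488024096454695680 * x ^ 6 + 63119199526198437323965440 * x ^ 7 +
      348297919939845136573440 * x ^ 8 + 1401772847345217699840 * x ^ 9 + 4012538055368376320
      * x ^ 10 + 7753906297896960 * x ^ 11 + 9081967083520 * x ^ 12 + 4875878400 * x ^ 13 := by
    positivity
  refine this.trans_eq ?_
  push_cast
  ring

/-! ### Degrees -/

theorem natDegree_codeFormSq_le (m : ℕ) (c : Fin (3 * m + 1) → ℤ) :
    (codeFormSq m c).natDegree ≤ 12 * m + 1 := by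
  refine natDegree_sum_le_of_forall_le _ _ fun j _ => ?_
  have h1 : (1 + X : ℤ[X]).natDegree ≤ 1 := by compute_degree
  have h2 : (X * (1 - X) ^ 2 : ℤ[X]).natDegree ≤ 3 := by compute_degree
  refine (natDegree_mul_le_of_le (natDegree_mul_le_of_le (natDegree_C _).le
    (natDegree_pow_le_of_le _ h1)) (natDegree_pow_le_of_le _ h2)).trans ?_
  omega

theorem natDegree_shadowFormFourth_le (m : ℕ) (d : Fin (3 * m + 1) → ℤ) :
    (shadowFormFourth m d).natDegree ≤ 6 * m := by
  refine natDegree_sum_le_of_forall_le _ _ fun j _ => ?_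
  have h1 : (1 - X : ℤ[X]).natDegree ≤ 1 := by compute_degree
  refine (natDegree_mul_le_of_le (natDegree_mul_le_of_le (natDegree_C _).le
    (natDegree_X_pow_le _)) (natDegree_pow_le_of_le _ h1)).trans ?_
  omega

/-! ### A bound for the coefficients -/

/-- The coefficients of `p` are bounded by those of `q`. -/
def IsDominated (p q : ℤ[X]) : Prop := ∀ i, |p.coeff i| ≤ q.coeff i

theorem IsDominated.mul {p q p' q' : ℤ[X]} (h : IsDominated p q) (h' : IsDominated p' q') :
    IsDominated (p * p') (q * q') := fun i => by
  rw [coeff_mul, coeff_mul]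
  refine (Finset.abs_sum_le_sum_abs _ _).trans (Finset.sum_le_sum fun x _ => ?_)
  rw [abs_mul]
  exact mul_le_mul (h _) (h' _) (abs_nonneg _) ((abs_nonneg _).trans (h _))

theorem isDominated_one : IsDominated 1 1 := fun i => by
  rw [coeff_one]; split_ifs <;> simp

theorem isDominated_X : IsDominated X X := fun i => by
  rw [coeff_X]; split_ifs <;> simp

theorem IsDominated.pow {p q : ℤ[X]} (h : IsDominated p q) (k : ℕ) :
    IsDominated (p ^ k) (q ^ k) := by
  induction k with
  | zero => simpa using isDominated_one
  | succ k ih => rw [pow_succ, pow_succ]; exact ih.mul h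

theorem IsDominated.C_mul {p q : ℤ[X]} (h : IsDominated p q) {a b : ℤ} (hab : |a| ≤ b) :
    IsDominated (C a * p) (C b * q) := fun i => by
  rw [coeff_C_mul, coeff_C_mul, abs_mul]
  exact mul_le_mul hab (h i) (abs_nonneg _) ((abs_nonneg _).trans hab)

theorem IsDominated.sum {ι : Type*} (s : Finset ι) {p q : ι → ℤ[X]}
    (h : ∀ i ∈ s, IsDominated (p i) (q i)) : IsDominated (∑ i ∈ s, p i) (∑ i ∈ s, q i) :=
  fun k => by
    rw [finsetSum_coeff, finsetSum_coeff]
    exact (Finset.abs_sum_le_sum_abs _ _).trans (Finset.sum_le_sum fun i hi => h i hi k)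

theorem isDominated_one_add_X : IsDominated (1 + X) (1 + X) := fun i => by
  rw [coeff_add, coeff_one, coeff_X]; split_ifs <;> simp

theorem isDominated_one_sub_X : IsDominated (1 - X) (1 + X) := fun i => by
  rw [coeff_add, coeff_sub, coeff_one, coeff_X]; split_ifs <;> simp_all

theorem IsDominated.abs_coeff_le {p q : ℤ[X]} (h : IsDominated p q) (i : ℕ) :
    |p.coeff i| ≤ q.eval 1 := by
  have hq : ∀ k, 0 ≤ q.coeff k := fun k => (abs_nonneg _).trans (h k)
  refine (h i).trans ?_
  rw [eval_eq_sum_range' (n := max q.natDegree i + 1) (by omega)]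
  simp only [one_pow, mul_one]
  exact Finset.single_le_sum (f := fun k => q.coeff k) (fun k _ => hq k)
    (Finset.mem_range.mpr (by omega))

/-- Replacing 1 - X by 1 + X dominates every coefficient, and each is at most the value at 1, where
(1+X)^(4(3m-j)+1) (X(1+X)²)^j becomes 2 · 16^(3m-j) · 4^j. -/
theorem abs_coeff_codeFormSq_le (m : ℕ) (n : ℕ → ℕ) (i : ℕ) :
    |(codeFormSq m fun j : Fin (3 * m + 1) => (-1) ^ (j : ℕ) * (n j : ℤ)).coeff i| ≤
      2 * ∑ j ∈ Finset.range (3 * m + 1), (n j : ℤ) * 16 ^ (3 * m - j) * 4 ^ j := by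
  have h : IsDominated (codeFormSq m fun j : Fin (3 * m + 1) => (-1) ^ (j : ℕ) * (n j : ℤ))
      (∑ j : Fin (3 * m + 1), C (n j : ℤ) *
        ((1 + X) ^ (12 * m + 1 - 4 * (j : ℕ)) * (X * (1 + X) ^ 2) ^ (j : ℕ))) := by
    refine IsDominated.sum _ fun j _ => ?_
    rw [mul_assoc]
    refine IsDominated.C_mul ?_ (by simp [abs_mul])
    exact (isDominated_one_add_X.pow _).mul ((isDominated_X.mul (isDominated_one_sub_X.pow _)).pow _)
  refine (h.abs_coeff_le i).trans_eq ?_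
  rw [eval_finsetSum, Finset.mul_sum, Finset.sum_range]
  refine Finset.sum_congr rfl fun j _ => ?_
  rw [show 12 * m + 1 - 4 * (j : ℕ) = 4 * (3 * m - j) + 1 by omega, pow_succ, pow_mul]
  norm_num
  ring

theorem abs_coeff_shadowFormFourth_le (m : ℕ) (d : ℕ → ℕ) (i : ℕ) :
    |(shadowFormFourth m fun j : Fin (3 * m + 1) => (d j : ℤ)).coeff i| ≤
      ∑ j ∈ Finset.range (3 * m + 1), (d j : ℤ) * 1 ^ (3 * m - j) * 4 ^ j := by
  have h : IsDominated (shadowFormFourth m fun j : Fin (3 * m + 1) => (d j : ℤ))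
      (∑ j : Fin (3 * m + 1), C (d j : ℤ) *
        (X ^ (3 * m - (j : ℕ)) * (1 + X) ^ (2 * (j : ℕ)))) := by
    refine IsDominated.sum _ fun j _ => ?_
    rw [mul_assoc]
    refine IsDominated.C_mul ?_ (by simp)
    exact (isDominated_X.pow _).mul (isDominated_one_sub_X.pow _)
  refine (h.abs_coeff_le i).trans_eq ?_
  rw [eval_finsetSum, Finset.sum_range]
  refine Finset.sum_congr rfl fun j _ => ?_
  rw [pow_mul]
  norm_num

/-! ### Reading off coefficients from the value at a power of two -/

/-- Uniqueness of digits: reduction modulo B forces f 0 = g 0 because they differ by less than B;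
cancel that term, divide by B and repeat. -/
theorem eq_of_sum_modEq {B : ℤ} (hB : 0 < B) {K : ℕ} {f g : ℕ → ℤ}
    (hfg : ∀ i < K, |f i - g i| < B)
    (h : ∑ i ∈ Finset.range K, f i * B ^ i ≡ ∑ i ∈ Finset.range K, g i * B ^ i [ZMOD B ^ K]) :
    ∀ i < K, f i = g i := by
  induction K generalizing f g with
  | zero => simp
  | succ K ih =>
    have e (f : ℕ → ℤ) : ∑ i ∈ Finset.range (K + 1), f i * B ^ i =
        f 0 + B * ∑ i ∈ Finset.range K, f (i + 1) * B ^ i := by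
      rw [Finset.sum_range_succ', add_comm, Finset.mul_sum, pow_zero, mul_one]
      congr 1
      exact Finset.sum_congr rfl fun i _ => by ring
    rw [e, e] at h
    have h0 : f 0 = g 0 := by
      have h1 := h.dvd
      have h2 : B ∣ g 0 - f 0 := by
        have := (dvd_pow_self B (Nat.succ_ne_zero K)).trans h1
        rw [show g 0 + B * ∑ i ∈ Finset.range K, g (i + 1) * B ^ i -
          (f 0 + B * ∑ i ∈ Finset.range K, f (i + 1) * B ^ i) = (g 0 - f 0) +
            B * (∑ i ∈ Finset.range K, g (i + 1) * B ^ i -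
              ∑ i ∈ Finset.range K, f (i + 1) * B ^ i) by ring] at this
        exact (dvd_add_left (dvd_mul_right B _)).mp this
      have h3 := hfg 0 (Nat.succ_pos K)
      rw [abs_sub_comm] at h3
      have := Int.eq_zero_of_abs_lt_dvd h2 h3
      linarith
    have h4 : ∑ i ∈ Finset.range K, f (i + 1) * B ^ i ≡
        ∑ i ∈ Finset.range K, g (i + 1) * B ^ i [ZMOD B ^ K] := by
      rw [h0, pow_succ'] at h
      exact Int.ModEq.mul_left_cancel' hB.ne' (Int.ModEq.add_left_cancel' _ h)
    have := ih (f := fun i => f (i + 1)) (g := fun i => g (i + 1))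
      (fun i hi => hfg _ (Nat.succ_lt_succ hi)) h4
    intro i hi
    rcases i with - | i
    · exact h0
    · exact this i (by omega)

theorem eval_modEq (p : ℤ[X]) (B : ℤ) (K : ℕ) :
    p.eval B ≡ ∑ i ∈ Finset.range K, p.coeff i * B ^ i [ZMOD B ^ K] := by
  rw [eval_eq_sum_range' (n := K + (p.natDegree + 1)) (by omega), Finset.sum_range_add]
  refine Int.modEq_iff_dvd.mpr ?_
  rw [sub_add_cancel_left, dvd_neg]
  refine Finset.dvd_sum fun i _ => ?_
  rw [pow_add]
  exact ⟨p.coeff (K + i) * B ^ i, by ring⟩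

theorem sum_digits (B w K : ℕ) :
    ∑ i ∈ Finset.range K, (w / B ^ i % B) * B ^ i = w % B ^ K := by
  induction K with
  | zero => simp [Nat.mod_one]
  | succ K ih => rw [Finset.sum_range_succ, ih, Nat.mod_pow_succ, mul_comm (B ^ K)]

theorem lt_of_land_two_pow_eq_zero {a s : ℕ} (ha : a < 2 ^ (s + 1)) (h : a &&& 2 ^ s = 0) :
    a < 2 ^ s := by
  by_contra hlt
  rw [not_lt] at hlt
  rw [Nat.and_two_pow] at h
  have h1 : a / 2 ^ s = 1 := by
    rw [Nat.div_eq_iff (by positivity)]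
    rw [pow_succ] at ha
    omega
  have : a.testBit s = true := by rw [Nat.testBit_eq_decide_div_mod_eq, h1]; rfl
  rw [this] at h
  simp at h

/-- The mask carries exactly the top bit of each of the K blocks of s + 1 bits, so one bitwise
operation tests all digits. -/
theorem digit_lt_of_land_eq_zero (s K w : ℕ)
    (h : w &&& (2 ^ s * ∑ i ∈ Finset.range K, (2 ^ (s + 1)) ^ i) = 0) :
    ∀ i < K, w / (2 ^ (s + 1)) ^ i % 2 ^ (s + 1) < 2 ^ s := by
  induction K generalizing w with
  | zero => simp
  | succ K ih =>
    have e : 2 ^ s * ∑ i ∈ Finset.range (K + 1), (2 ^ (s + 1)) ^ i =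
        2 ^ s + 2 ^ (s + 1) * (2 ^ s * ∑ i ∈ Finset.range K, (2 ^ (s + 1)) ^ i) := by
      rw [Finset.sum_range_succ', mul_add, Finset.mul_sum, Finset.mul_sum, Finset.mul_sum,
        add_comm]
      congr 1
      · simp
      · exact Finset.sum_congr rfl fun i _ => by ring
    have hlt : 2 ^ s < 2 ^ (s + 1) := Nat.pow_lt_pow_right (by norm_num) (Nat.lt_succ_self s)
    rw [e] at h
    have h0 : w % 2 ^ (s + 1) &&& 2 ^ s = 0 := by
      have := congrArg (· % 2 ^ (s + 1)) h
      simpa [Nat.and_mod_two_pow, Nat.mod_eq_of_lt hlt] using this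
    have h1 : w / 2 ^ (s + 1) &&& (2 ^ s * ∑ i ∈ Finset.range K, (2 ^ (s + 1)) ^ i) = 0 := by
      have := congrArg (· / 2 ^ (s + 1)) h
      simp only [Nat.and_div_two_pow, Nat.zero_div] at this
      rwa [Nat.add_mul_div_left _ _ (by positivity), Nat.div_eq_of_lt hlt, zero_add] at this
    intro i hi
    rcases i with - | i
    · simpa using lt_of_land_two_pow_eq_zero (Nat.mod_lt _ (by positivity)) h0
    · have := ih _ h1 i (by omega)
      rwa [Nat.div_div_eq_div_mul, ← pow_succ'] at this

/-- If the value of `p` at a large power of two has digits without leading bits, then these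
digits are the coefficients of `p`. -/
theorem coeff_eq_digit {p : ℤ[X]} {s K w : ℕ}
    (hw : (w : ℤ) = p.eval (2 ^ (s + 1)))
    (hp : ∀ i, |p.coeff i| < 2 ^ s)
    (h : w &&& (2 ^ s * ∑ i ∈ Finset.range K, (2 ^ (s + 1)) ^ i) = 0) (i : ℕ) (hi : i < K) :
    p.coeff i = (w / (2 ^ (s + 1)) ^ i % 2 ^ (s + 1) : ℕ) := by
  refine eq_of_sum_modEq (B := 2 ^ (s + 1)) (by positivity) (K := K) (f := p.coeff)
    (g := fun i => (w / (2 ^ (s + 1)) ^ i % 2 ^ (s + 1) : ℕ)) (fun i hi => ?_) ?_ i hi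
  -- The coefficient lies in (-2^s, 2^s) and the digit in [0, 2^s), so they differ by less than the
  -- base 2^(s+1).
  · have h1 := digit_lt_of_land_eq_zero s K w h i hi
    have h2 := hp i
    rw [abs_lt] at h2 ⊢
    zify at h1 ⊢
    have h3 : (0 : ℤ) ≤ (w : ℤ) / (2 ^ (s + 1)) ^ i % 2 ^ (s + 1) :=
      Int.emod_nonneg _ (by positivity)
    rw [pow_succ] at *
    constructor <;> linarith
  · refine (eval_modEq p _ K).symm.trans ?_
    rw [← hw]
    have := sum_digits (2 ^ (s + 1)) w K
    have h4 : (∑ i ∈ Finset.range K, ((w / (2 ^ (s + 1)) ^ i % 2 ^ (s + 1) : ℕ) : ℤ) *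
        (2 ^ (s + 1)) ^ i) = ((w % (2 ^ (s + 1)) ^ K : ℕ) : ℤ) := by
      rw [← this]; push_cast; rfl
    rw [h4]
    push_cast
    exact (Int.mod_modEq _ _).symm

theorem digit_of_mod_eq_one {B w L : ℕ} (hB : 1 < B) (hL : w % B ^ L = 1) (i : ℕ) (hi : i < L) :
    w / B ^ i % B = if i = 0 then 1 else 0 := by
  have h1 : w / B ^ i % B = w % B ^ L / B ^ i % B := by
    obtain ⟨r, rfl⟩ : ∃ r, L = i + (r + 1) := ⟨L - i - 1, by omega⟩
    rw [pow_add, Nat.mod_mul_right_div_self, pow_succ, Nat.mod_mod_of_dvd _ (dvd_mul_left _ _)]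
  rw [h1, hL]
  split_ifs with h
  · subst h; simpa using Nat.mod_eq_of_lt hB
  · rw [Nat.div_eq_of_lt (Nat.one_lt_pow h hB), Nat.zero_mod]

/-! ### The computation for `m ≤ 154` -/

/-- The homogeneous form `∑ l_i A^{k-1-i} B^i` with coefficients `l = [l_0, …, l_{k-1}]`. -/
def horner (A B : ℤ) : List ℕ → ℤ
  | [] => 0
  | a :: l => a * A ^ l.length + B * horner A B l

theorem horner_eq_sum (A B : ℤ) (l : List ℕ) : horner A B l =
    ∑ i ∈ Finset.range l.length, (l.getD i 0 : ℤ) * A ^ (l.length - 1 - i) * B ^ i := by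
  induction l with
  | nil => simp [horner]
  | cons a l ih =>
    rw [horner, ih, List.length_cons, Finset.sum_range_succ', add_comm, Finset.mul_sum]
    simp only [List.getD_cons_succ, List.getD_cons_zero, pow_zero, mul_one, Nat.add_sub_cancel,
      Nat.sub_zero]
    congr 1
    refine Finset.sum_congr rfl fun i _ => ?_
    rw [show l.length - (i + 1) = l.length - 1 - i by omega]
    ring

/-- One step of binary splitting: adjacent entries are combined. A last unpaired entry is
dropped. -/
def pairUp (A B : ℕ) : List ℕ → List ℕ
  | a :: b :: l => (a * A + b * B) :: pairUp A B l
  | _ => []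

/-- `pairUp`, with a minus sign. -/
def pairSub (A B : ℕ) : List ℕ → List ℕ
  | a :: b :: l => (a * A - b * B) :: pairSub A B l
  | _ => []

/-- The subtractions in `pairSub` are not truncated. -/
def pairSubOk (A B : ℕ) : List ℕ → Bool
  | a :: b :: l => Nat.ble (b * B) (a * A) && pairSubOk A B l
  | _ => true

/-- The last entry of a list of odd length. -/
def lastOfOdd : List ℕ → Option ℕ
  | _ :: _ :: l => lastOfOdd l
  | [a] => some a
  | [] => none

/-- `Q ∑ l_i A^{k-1-i} B^i + R B^k` for a list of length `k < 2^f`, by binary splitting. -/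
def splitLoop : ℕ → ℕ → ℕ → ℕ → ℕ → List ℕ → ℕ
  | 0, _, _, _, R, _ => R
  | f + 1, A, B, Q, R, l =>
    match lastOfOdd l with
    | none => splitLoop f (A * A) (B * B) Q R (pairUp A B l)
    | some a => splitLoop f (A * A) (B * B) (Q * A) (Q * a + R * B) (pairUp A B l)

/-- `∑ (-1)^i l_i A^{k-1-i} B^i`. -/
def altSplit (f A B : ℕ) (l : List ℕ) : ℕ :=
  match lastOfOdd l with
  | none => splitLoop f (A * A) (B * B) 1 0 (pairSub A B l)
  | some a => splitLoop f (A * A) (B * B) A a (pairSub A B l)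

/-- Grouping neighbours, l_{2i} A + l_{2i+1} B becomes the i-th entry of a form in A², B² of half
the length; an unpaired last entry costs a factor A and leaves a term in (B²)^k. -/
theorem pairUp_spec (A B : ℕ) (l : List ℕ) :
    2 * (pairUp A B l).length + (lastOfOdd l).isSome.toNat = l.length ∧
    horner A B l = match lastOfOdd l with
      | none => horner (A * A) (B * B) (pairUp A B l)
      | some a => A * horner (A * A) (B * B) (pairUp A B l) +
          a * (B * B) ^ (pairUp A B l).length := by
  induction l using pairUp.induct with
  | case1 a b l ih =>
    obtain ⟨h1, h2⟩ := ih
    refine ⟨by simp only [pairUp, lastOfOdd, List.length_cons, ← h1]; omega, ?_⟩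
    simp only [pairUp, lastOfOdd, horner, List.length_cons, h2]
    cases h : lastOfOdd l with
    | none =>
      simp only [h, Option.isSome_none, Bool.toNat_false, add_zero] at h1
      rw [← h1]
      push_cast
      ring
    | some c =>
      simp only [h, Option.isSome_some, Bool.toNat_true] at h1
      rw [← h1]
      push_cast
      ring
  | case2 l hl =>
    rcases l with - | ⟨a, - | ⟨b, l⟩⟩
    · simp [pairUp, lastOfOdd, horner]
    · simp [pairUp, lastOfOdd, horner]
    · exact absurd rfl (hl a b l)

/-- Signs matter only at the first level, because (-B)² = B². Once the first subtractions are known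
not to truncate, the remaining evaluation is over natural numbers. -/
theorem pairSub_spec (A B : ℕ) (l : List ℕ) (hl : pairSubOk A B l = true) :
    2 * (pairSub A B l).length + (lastOfOdd l).isSome.toNat = l.length ∧
    horner A (-B) l = match lastOfOdd l with
      | none => horner (A * A) (B * B) (pairSub A B l)
      | some a => A * horner (A * A) (B * B) (pairSub A B l) +
          a * (B * B) ^ (pairSub A B l).length := by
  induction l using pairSub.induct with
  | case1 a b l ih =>
    rw [pairSubOk, Bool.and_eq_true, Nat.ble_eq] at hl
    obtain ⟨h1, h2⟩ := ih hl.2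
    refine ⟨by simp only [pairSub, lastOfOdd, List.length_cons, ← h1]; omega, ?_⟩
    simp only [pairSub, lastOfOdd, horner, List.length_cons, h2]
    cases h : lastOfOdd l with
    | none =>
      simp only [h, Option.isSome_none, Bool.toNat_false, add_zero] at h1
      rw [← h1]
      push_cast [Nat.cast_sub hl.1]
      ring
    | some c =>
      simp only [h, Option.isSome_some, Bool.toNat_true] at h1
      rw [← h1]
      push_cast [Nat.cast_sub hl.1]
      ring
  | case2 l hl' =>
    rcases l with - | ⟨a, - | ⟨b, l⟩⟩
    · simp [pairSub, lastOfOdd, horner]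
    · simp [pairSub, lastOfOdd, horner]
    · exact absurd rfl (hl' a b l)

/-- `Q` and `R` absorb the unpaired entries: Q(A h + a B^(2k)) + R B^(2k+1) = (QA) h + (Qa +
RB)(B²)^k. -/
theorem splitLoop_eq (f A B Q R : ℕ) (l : List ℕ) (hl : l.length < 2 ^ f) :
    (splitLoop f A B Q R l : ℤ) = Q * horner A B l + R * B ^ l.length := by
  induction f generalizing A B Q R l with
  | zero =>
    obtain rfl : l = [] := List.length_eq_zero_iff.mp (by simpa using hl)
    simp [splitLoop, horner]
  | succ f ih =>
    obtain ⟨h1, h2⟩ := pairUp_spec A B l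
    have h3 : (pairUp A B l).length < 2 ^ f := by rw [pow_succ] at hl; omega
    rw [splitLoop]
    cases h : lastOfOdd l with
    | none =>
      simp only [h, Option.isSome_none, Bool.toNat_false, add_zero] at h1 h2 ⊢
      rw [ih _ _ _ _ _ h3, h2, ← h1, pow_mul]
      push_cast
      ring
    | some c =>
      simp only [h, Option.isSome_some, Bool.toNat_true] at h1 h2 ⊢
      rw [ih _ _ _ _ _ h3, h2, ← h1, pow_succ, pow_mul]
      push_cast
      ring

theorem altSplit_eq (f A B : ℕ) (l : List ℕ) (hl : l.length < 2 ^ f)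
    (hok : pairSubOk A B l = true) : (altSplit f A B l : ℤ) = horner A (-B) l := by
  obtain ⟨h1, h2⟩ := pairSub_spec A B l hok
  rw [altSplit]
  cases h : lastOfOdd l with
  | none =>
    simp only [h] at h1 h2 ⊢
    rw [splitLoop_eq _ _ _ _ _ _ (by omega), h2]
    push_cast
    ring
  | some c =>
    simp only [h] at h1 h2 ⊢
    rw [splitLoop_eq _ _ _ _ _ _ (by omega), h2]
    push_cast
    ring

/-- `P A^k + T ∑ l_i A^{k-1-i} B^i`, by Horner's scheme. -/
def hornerLoop (A B : ℕ) : ℕ → ℕ → List ℕ → ℕ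
  | P, _, [] => P
  | P, T, a :: l => hornerLoop A B (P * A + a * T) (T * B) l

theorem hornerLoop_eq (A B : ℕ) (l : List ℕ) (P T : ℕ) :
    (hornerLoop A B P T l : ℤ) = P * A ^ l.length + T * horner A B l := by
  induction l generalizing P T with
  | nil => simp [hornerLoop, horner]
  | cons a l ih =>
    rw [hornerLoop, horner, List.length_cons, ih]
    push_cast
    ring

/-- The numbers `d_j = n_j 2^{N-6j}`, starting at a given `j`. -/
def shadowList (N : ℕ) : ℕ → List ℕ → List ℕ
  | _, [] => []
  | j, a :: l => a * 2 ^ N / 2 ^ (6 * j) :: shadowList N (j + 1) l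

/-- The divisions in `shadowList` are exact. -/
def shadowListOk (N : ℕ) : ℕ → List ℕ → Bool
  | _, [] => true
  | j, a :: l => Nat.beq (a * 2 ^ N / 2 ^ (6 * j) * 2 ^ (6 * j)) (a * 2 ^ N) &&
      shadowListOk N (j + 1) l

theorem length_shadowList (N j : ℕ) (l : List ℕ) : (shadowList N j l).length = l.length := by
  induction l generalizing j with
  | nil => rfl
  | cons a l ih => simp [shadowList, ih]

theorem getD_shadowList {N j : ℕ} {l : List ℕ} (h : shadowListOk N j l = true) (i : ℕ) :
    (shadowList N j l).getD i 0 * 2 ^ (6 * (j + i)) = l.getD i 0 * 2 ^ N := by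
  induction l generalizing j i with
  | nil => simp [shadowList]
  | cons a l ih =>
    rw [shadowListOk, Bool.and_eq_true, Nat.beq_eq] at h
    rw [shadowList]
    rcases i with - | i
    · simpa using h.1
    · have := ih h.2 i
      rw [List.getD_cons_succ, List.getD_cons_succ, ← this]
      congr 3
      ring

/-- No digit of `w` in base `2^{s+1}` has its leading bit set, for the first `K` digits. -/
def leadingBitsVanish (s K w : ℕ) : Bool :=
  Nat.beq (w &&& (2 ^ s * ((2 ^ ((s + 1) * K) - 1) / (2 ^ (s + 1) - 1)))) 0

/-- The certificate for `|c_j| = l_j` and `|d_j| = d_j` in base `2^{s+1}`. -/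
def certificateAux (m s : ℕ) (l d : List ℕ) (w v : ℕ) : Bool :=
  Nat.beq l.length (3 * m + 1) && shadowListOk (12 * m + 1) 0 l &&
  pairSubOk ((1 + 2 ^ (s + 1)) ^ 4) ((2 ^ (s + 1) - 1) ^ 2 * 2 ^ (s + 1)) l &&
  Nat.ble (2 * hornerLoop 16 4 0 1 l + 1) (2 ^ s) &&
  Nat.ble (hornerLoop 1 4 0 1 d + 1) (2 ^ s) &&
  leadingBitsVanish s (12 * m + 2) w && leadingBitsVanish s (6 * m + 1) v &&
  Nat.beq (w &&& (2 ^ ((s + 1) * (2 * m + 1)) - 1)) 1 &&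
  Nat.beq (v &&& (2 ^ ((s + 1) * m) - 1)) 1

/-- The certificate for `|c_j| = l_j` in base `2^{s+1}`. -/
def certificate (m s f : ℕ) (l : List ℕ) : Bool :=
  Nat.ble (3 * m + 2) (2 ^ f) &&
  certificateAux m s l (shadowList (12 * m + 1) 0 l)
    ((1 + 2 ^ (s + 1)) * altSplit f ((1 + 2 ^ (s + 1)) ^ 4)
      ((2 ^ (s + 1) - 1) ^ 2 * 2 ^ (s + 1)) l)
    (splitLoop f (2 ^ (s + 1)) ((2 ^ (s + 1) - 1) ^ 2) 1 0 (shadowList (12 * m + 1) 0 l))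

/-- `n_j` from `n_{j-1} = a` and `n_{j-2} = b` for `2 ≤ j ≤ 2m`, where `N = 12m + 1`. -/
def nextCoeff (N j a b : ℕ) : ℕ :=
  ((78 + 85 * N + 9 * N ^ 2 + 2 * N ^ 3 + (398 + 204 * N + 12 * N ^ 2) * j ^ 2 + 64 * j ^ 4) * a
    + 2 * ((N + 8 - 4 * j) * (N + 7 - 4 * j) * (N + 6 - 4 * j) * (N + 5 - 4 * j)) * b
    - ((284 + 225 * N + 21 * N ^ 2 + 2 * N ^ 3) * j + (256 + 64 * N) * j ^ 3) * a)
  / (j * (j - 1) * (2 * j - 1) * (N - j))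

/-- Prepends `n_{3m-k}, n_{3m-k-1}, …` (`f` terms, in reverse order) to a list. -/
def upperCoeffs (m : ℕ) : ℕ → ℕ → ℕ → List ℕ → List ℕ
  | 0, _, _, acc => acc
  | f + 1, k, e, acc => upperCoeffs m f (k + 1)
      (e * ((6 * m - 2 * k) * (6 * m - 2 * k - 1)) / ((k + 1) * (6 * m - k - 1)))
      (e * 2 ^ (6 * m - 1 - 6 * k) :: acc)

/-- Prepends `n_j, n_{j+1}, …` (`f` terms, `a = n_j`, `b = n_{j-1}`) to a list. -/
def lowerCoeffs (N : ℕ) (tail : List ℕ) : ℕ → ℕ → ℕ → ℕ → List ℕ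
  | 0, _, _, _ => tail
  | f + 1, j, a, b =>
    a :: lowerCoeffs N tail f (j + 1) (if j = 0 then N else nextCoeff N (j + 1) a b) a

/-- The list of the `|c_j|` of the admissible `c`. -/
def absCoeffs (m : ℕ) : List ℕ :=
  lowerCoeffs (12 * m + 1) (upperCoeffs m m 0 1 []) (2 * m + 1) 0 1 0

/-- The certificate for `m`, with a base adapted to the size of the coefficients. -/
def check (m : ℕ) : Bool :=
  certificate m (Nat.log2 (2 * hornerLoop 16 4 0 1 (absCoeffs m)) + 1) (Nat.log2 (3 * m + 1) + 1)
    (absCoeffs m)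

/-! ### Soundness of the certificate -/

theorem hasNonnegIntCoeffs_of_eq_expand {p : ℤ[X]} {q : ℚ[X]} {k : ℕ} (hk : 0 < k)
    (hq : q = expand ℚ k (p.map (Int.castRingHom ℚ))) (hp : ∀ i, 0 ≤ p.coeff i) :
    HasNonnegIntCoeffs q := fun i => by
  rw [hq, coeff_expand hk]
  split_ifs with h
  · refine ⟨(p.coeff (i / k)).toNat, ?_⟩
    rw [coeff_map, eq_intCast]
    exact_mod_cast (Int.toNat_of_nonneg (hp _)).symm
  · exact ⟨0, by simp⟩

theorem HasNonnegIntCoeffs.X_mul {q : ℚ[X]} (h : HasNonnegIntCoeffs q) :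
    HasNonnegIntCoeffs (X * q) := fun i => by
  rcases i with - | i
  · exact ⟨0, by simp⟩
  · rw [coeff_X_mul]; exact h i

theorem eval_codeFormSq (m : ℕ) (l : List ℕ) (hl : l.length = 3 * m + 1) (B : ℤ) :
    (codeFormSq m fun j : Fin (3 * m + 1) => (-1) ^ (j : ℕ) * (l.getD j 0 : ℤ)).eval B =
      (1 + B) * horner ((1 + B) ^ 4) (-((B - 1) ^ 2 * B)) l := by
  rw [codeFormSq, eval_finsetSum, horner_eq_sum, hl, Finset.mul_sum, Finset.sum_range]
  refine Finset.sum_congr rfl fun j _ => ?_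
  rw [show 12 * m + 1 - 4 * (j : ℕ) = 4 * (3 * m + 1 - 1 - j) + 1 by omega, pow_succ, pow_mul,
    neg_pow ((B - 1) ^ 2 * B)]
  simp only [eval_mul, eval_C, eval_pow, eval_add, eval_one, eval_X, eval_sub]
  rw [show B * (1 - B) ^ 2 = (B - 1) ^ 2 * B by ring]
  ring

theorem eval_shadowFormFourth (m : ℕ) (l : List ℕ) (hl : l.length = 3 * m + 1) (B : ℤ) :
    (shadowFormFourth m fun j : Fin (3 * m + 1) => (l.getD j 0 : ℤ)).eval B =
      horner B ((B - 1) ^ 2) l := by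
  rw [shadowFormFourth, eval_finsetSum, horner_eq_sum, hl, Finset.sum_range]
  refine Finset.sum_congr rfl fun j _ => ?_
  simp only [eval_mul, eval_C, eval_pow, eval_one, eval_X, eval_sub]
  rw [← pow_mul, Nat.add_sub_cancel, pow_mul, show (1 - B) ^ 2 = (B - 1) ^ 2 by ring, pow_mul]

theorem land_eq_zero_of_leadingBitsVanish {s K w : ℕ} (h : leadingBitsVanish s K w = true) :
    w &&& (2 ^ s * ∑ i ∈ Finset.range K, (2 ^ (s + 1)) ^ i) = 0 := by
  rw [leadingBitsVanish, Nat.beq_eq, pow_mul] at h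
  rwa [Nat.geomSum_eq (Nat.le_self_pow (Nat.succ_ne_zero s) 2)]

/-- If the certificate is accepted, then the admissible forms have nonnegative integer
coefficients. -/
theorem exists_of_certificate {m s f : ℕ} {l : List ℕ} (hm : 1 ≤ m)
    (h : certificate m s f l = true) :
    ∃ c : Fin (3 * m + 1) → ℚ, IsAdmissible m c ∧ HasNonnegIntCoeffs (codeForm m c) ∧
      HasNonnegIntCoeffs (shadowForm m c) := by
  rw [certificate, Bool.and_eq_true, Nat.ble_eq] at h
  obtain ⟨hf, h⟩ := h
  set d := shadowList (12 * m + 1) 0 l with hd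
  set w := (1 + 2 ^ (s + 1)) * altSplit f ((1 + 2 ^ (s + 1)) ^ 4)
      ((2 ^ (s + 1) - 1) ^ 2 * 2 ^ (s + 1)) l with hw
  set v := splitLoop f (2 ^ (s + 1)) ((2 ^ (s + 1) - 1) ^ 2) 1 0 d with hv
  simp only [certificateAux, Bool.and_eq_true, Nat.ble_eq, Nat.beq_eq] at h
  obtain ⟨⟨⟨⟨⟨⟨⟨⟨hl, hdok⟩, hlok⟩, hbw⟩, hbv⟩, htw⟩, htv⟩, hlw⟩, hlv⟩ := h
  have hdl : d.length = 3 * m + 1 := by rw [hd, length_shadowList, hl]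
  have hB : 1 ≤ 2 ^ (s + 1) := Nat.one_le_two_pow
  set Wz : ℤ[X] := codeFormSq m fun j : Fin (3 * m + 1) => (-1) ^ (j : ℕ) * (l.getD j 0 : ℤ)
    with hWz
  set Vz : ℤ[X] := shadowFormFourth m fun j : Fin (3 * m + 1) => (d.getD j 0 : ℤ) with hVz
  have ew : (w : ℤ) = Wz.eval (2 ^ (s + 1)) := by
    rw [hWz, eval_codeFormSq m l hl, hw]
    push_cast
    rw [altSplit_eq f _ _ l (by omega) hlok]
    push_cast [Nat.cast_sub hB]
    rfl
  have ev : (v : ℤ) = Vz.eval (2 ^ (s + 1)) := by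
    rw [hVz, eval_shadowFormFourth m d hdl, hv, splitLoop_eq f _ _ _ _ d (by omega)]
    push_cast [Nat.cast_sub hB]
    ring
  have bw (i : ℕ) : |Wz.coeff i| < 2 ^ s := by
    refine (abs_coeff_codeFormSq_le m (fun j => l.getD j 0) i).trans_lt ?_
    have h1 := hornerLoop_eq 16 4 l 0 1
    rw [horner_eq_sum, hl] at h1
    zify at hbw
    rw [h1] at hbw
    simp only [Nat.add_sub_cancel] at hbw
    push_cast at hbw
    linarith
  have bv (i : ℕ) : |Vz.coeff i| < 2 ^ s := by
    refine (abs_coeff_shadowFormFourth_le m (fun j => d.getD j 0) i).trans_lt ?_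
    have h1 := hornerLoop_eq 1 4 d 0 1
    rw [horner_eq_sum, hdl] at h1
    zify at hbv
    rw [h1] at hbv
    simp only [Nat.add_sub_cancel] at hbv
    push_cast at hbv
    linarith
  have cw := coeff_eq_digit ew bw (land_eq_zero_of_leadingBitsVanish htw)
  have cv := coeff_eq_digit ev bv (land_eq_zero_of_leadingBitsVanish htv)
  -- Digits are natural numbers, and beyond the tested range the coefficients vanish by degree.
  have nw (i : ℕ) : 0 ≤ Wz.coeff i := by
    rcases lt_or_ge i (12 * m + 2) with hi | hi
    · rw [cw i hi]; positivity
    · rw [coeff_eq_zero_of_natDegree_lt ((natDegree_codeFormSq_le m _).trans_lt hi)]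
  have nv (i : ℕ) : 0 ≤ Vz.coeff i := by
    rcases lt_or_ge i (6 * m + 1) with hi | hi
    · rw [cv i hi]; positivity
    · rw [coeff_eq_zero_of_natDegree_lt ((natDegree_shadowFormFourth_le m _).trans_lt hi)]
  have hB' : 1 < 2 ^ (s + 1) := Nat.one_lt_two_pow (Nat.succ_ne_zero s)
  -- The low masks are reductions modulo powers of the base. A residue of 1 means that the leading
  -- digits are 1, 0, …, 0, which is admissibility.
  rw [Nat.and_two_pow_sub_one_eq_mod, pow_mul] at hlw hlv
  have dw (i : ℕ) (hi : i < 2 * m + 1) : Wz.coeff i = if i = 0 then 1 else 0 := by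
    rw [cw i (by omega), digit_of_mod_eq_one hB' hlw i hi]; split_ifs <;> rfl
  have dv (i : ℕ) (hi : i < m) : Vz.coeff i = if i = 0 then 1 else 0 := by
    rw [cv i (by omega), digit_of_mod_eq_one hB' hlv i hi]; split_ifs <;> rfl
  -- The alternating signs cancel those in `shadowCoeff`, so that every d_j is nonnegative.
  let c : Fin (3 * m + 1) → ℚ := fun j => (-1) ^ (j : ℕ) * (l.getD j 0 : ℚ)
  have mw : codeFormSq m c = Wz.map (Int.castRingHom ℚ) := by
    simp [c, hWz, codeFormSq, Polynomial.map_sum]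
  have hsc : shadowCoeff m c = fun j : Fin (3 * m + 1) => (d.getD j 0 : ℚ) := by
    ext j
    have h1 : ((d.getD j 0 : ℕ) : ℚ) * 2 ^ (6 * (0 + j : ℕ)) = l.getD j 0 * 2 ^ (12 * m + 1) := by
      exact_mod_cast getD_shadowList hdok j
    have h2 : (2 : ℚ) ^ (12 * (m : ℤ) + 1 - 6 * ((j : ℕ) : ℤ)) =
        2 ^ (12 * m + 1) / 2 ^ (6 * (0 + j : ℕ)) := by
      rw [zpow_sub₀ (by norm_num), zero_add]
      norm_cast
    simp only [shadowCoeff, c]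
    rw [h2, ← mul_assoc, ← mul_pow, mul_div_assoc', neg_mul_neg, one_mul, one_pow, one_mul, ← h1,
      mul_div_assoc, div_self (by positivity), mul_one]
  have mv : shadowFormFourth m (shadowCoeff m c) = Vz.map (Int.castRingHom ℚ) := by
    rw [hsc]
    simp [hVz, shadowFormFourth, Polynomial.map_sum]
  refine ⟨c, isAdmissible_iff.mpr ?_, ?_, ?_⟩
  · rw [mw, mv]
    simp only [coeff_map, eq_intCast]
    refine ⟨?_, fun i h1 h2 => ?_, ?_, fun i h1 h2 => ?_⟩
    · rw [dw 0 (by omega)]; simp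
    · rw [dw i (by omega), if_neg (by omega)]; simp
    · rw [dv 0 (by omega)]; simp
    · rw [dv i (by omega), if_neg (by omega)]; simp
  · exact hasNonnegIntCoeffs_of_eq_expand (k := 2) (by norm_num) (by rw [codeForm_eq_expand, mw]) nw
  · rw [shadowForm_eq_X_mul_expand, mv]
    exact (hasNonnegIntCoeffs_of_eq_expand (by norm_num) rfl nv).X_mul

/-! ### Gleason's theorem -/

theorem eq_of_eval_eq_off {p q : ℚ[X]} (s : Finset ℚ) (h : ∀ y ∉ s, p.eval y = q.eval y) :
    p = q :=
  eq_of_infinite_eval_eq p q ((s.finite_toSet.infinite_compl).mono fun y hy => h y hy)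

/-- The homogenised substitution `y ↦ (1 - y) / (1 + y)` in degree `N`. -/
def mobiusForm (N : ℕ) (q : ℚ[X]) : ℚ[X] :=
  ∑ k ∈ Finset.range (N + 1), C (q.coeff k) * ((1 + X) ^ (N - k) * (1 - X) ^ k)

theorem eval_mobiusForm {N : ℕ} {q : ℚ[X]} (hq : q.natDegree ≤ N) {y : ℚ} (hy : 1 + y ≠ 0) :
    (mobiusForm N q).eval y = (1 + y) ^ N * q.eval ((1 - y) / (1 + y)) := by
  rw [mobiusForm, eval_finsetSum, eval_eq_sum_range' (n := N + 1) (by omega), Finset.mul_sum]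
  refine Finset.sum_congr rfl fun k hk => ?_
  rw [Finset.mem_range] at hk
  simp only [eval_mul, eval_C, eval_pow, eval_add, eval_sub, eval_one, eval_X]
  rw [pow_sub_mul_pow_eq (by omega) hy]
  ring

theorem reflect_eq_of_eval {n : ℕ} {D : ℚ[X]} (hD : D.natDegree ≤ n) (s : Finset ℚ)
    (h : ∀ y ∉ s, y ≠ 0 → y ^ n * D.eval y⁻¹ = D.eval y) : reflect n D = D := by
  refine eq_of_eval_eq_off (insert 0 (s ∪ s.image (·⁻¹))) fun y hy => ?_
  simp only [Finset.mem_insert, Finset.mem_union, Finset.mem_image, not_or] at hy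
  obtain ⟨hy0, hys, hyi⟩ := hy
  have hy' : y⁻¹ ∉ s := fun hc => hyi ⟨y⁻¹, hc, inv_inv y⟩
  let _ : Invertible y⁻¹ := invertibleOfNonzero (inv_ne_zero hy0)
  have h1 := eval₂_reflect_mul_pow (RingHom.id ℚ) y⁻¹ n D hD
  rw [invOf_eq_inv, inv_inv] at h1
  have h2 := h y⁻¹ hy' (inv_ne_zero hy0)
  rw [inv_inv] at h2
  have h3 := h y hys hy0
  rw [← eval₂_id, ← eval₂_id] at h3
  rw [← eval₂_id, ← eval₂_id, ← h3, ← h1, mul_left_comm, ← mul_pow, mul_inv_cancel₀ hy0]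
  simp

/-- An even polynomial of degree at most `2h` that is invariant under the MacWilliams transform
and divisible by a high power of `y` vanishes. -/
theorem eq_zero_of_invariant {h K : ℕ} (hK : 2 * h < 4 * K) {D : ℚ[X]} (hD : D.natDegree ≤ 2 * h)
    (heven : D.comp (-X) = D)
    (hinv : ∀ y : ℚ, 1 + y ≠ 0 →
      2 ^ h * D.eval y = (1 + y) ^ (2 * h) * D.eval ((1 - y) / (1 + y)))
    (hlow : ∀ k < K, D.coeff k = 0) : D = 0 := by
  by_contra hne
  have hev (y : ℚ) : D.eval (-y) = D.eval y := by
    conv_rhs => rw [← heven]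
    simp
  have hXK : (X : ℚ[X]) ^ K ∣ D := X_pow_dvd_iff.mpr hlow
  obtain ⟨q, rfl⟩ := hXK
  have hq0 : q ≠ 0 := right_ne_zero_of_mul hne
  have hdeg : (X ^ K * q).natDegree = K + q.natDegree := by
    rw [natDegree_mul (pow_ne_zero _ X_ne_zero) hq0, natDegree_X_pow]
  have hq : q.natDegree ≤ 2 * h - K := by omega
  have hKn : K ≤ 2 * h := by omega
  -- divisibility by `(1 - X) ^ K`
  have h1 : (1 - X : ℚ[X]) ^ K ∣ X ^ K * q := by
    -- The transform turns the factor y^K into ((1-y)/(1+y))^K, and (1+y)^(2h) clears the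
    -- denominators.
    have e : C (2 ^ h : ℚ) * (X ^ K * q) = (1 - X) ^ K * mobiusForm (2 * h - K) q := by
      refine eq_of_eval_eq_off {-1} fun y hy => ?_
      have hy1 : 1 + y ≠ 0 := fun hc => hy (by
        rw [Finset.mem_singleton]; linarith)
      rw [eval_mul, eval_C, hinv y hy1, eval_mul (p := (1 - X) ^ K), eval_mobiusForm hq hy1]
      simp only [eval_mul, eval_pow, eval_X, eval_sub, eval_one]
      rw [div_pow]
      obtain ⟨k, hk⟩ := Nat.exists_eq_add_of_le' hKn
      rw [hk, Nat.add_sub_cancel, pow_add]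
      field_simp
    have h2 : (1 - X : ℚ[X]) ^ K ∣ C (2 ^ h : ℚ) * (X ^ K * q) := e ▸ dvd_mul_right _ _
    have hu : IsUnit (C (2 ^ h : ℚ)) := isUnit_C.mpr (IsUnit.mk0 _ (by positivity))
    exact hu.dvd_mul_left.mp h2
  -- Evenness carries the zero at 1 to -1.
  have h2 : (1 + X : ℚ[X]) ^ K ∣ X ^ K * q := by
    obtain ⟨r, hr⟩ := h1
    refine ⟨r.comp (-X), ?_⟩
    rw [← heven, hr]
    simp
  have c1 : IsCoprime (X : ℚ[X]) (1 - X) := ⟨1, 1, by ring⟩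
  have c2 : IsCoprime (X : ℚ[X]) (1 + X) := ⟨-1, 1, by ring⟩
  have c3 : IsCoprime (1 - X : ℚ[X]) (1 + X) := by
    refine ⟨C 2⁻¹, C 2⁻¹, ?_⟩
    rw [← mul_add, show (1 - X + (1 + X) : ℚ[X]) = C 2 by rw [map_ofNat]; ring, ← C_mul]
    norm_num
  have h3 : (X : ℚ[X]) ^ K * (1 - X) ^ K * (1 + X) ^ K ∣ X ^ K * q :=
    IsCoprime.mul_dvd (IsCoprime.mul_left c2.pow c3.pow)
      (IsCoprime.mul_dvd c1.pow (dvd_mul_right _ _) h1) h2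
  have h4 : 3 * K ≤ (X ^ K * q).natDegree := by
    have := natDegree_le_of_dvd h3 hne
    have e1 : (1 - X : ℚ[X]).natDegree = 1 := by
      rw [← neg_sub, natDegree_neg]; exact natDegree_X_sub_C (1 : ℚ)
    have e2 : (1 + X : ℚ[X]).natDegree = 1 := by
      rw [add_comm]; exact natDegree_X_add_C (1 : ℚ)
    have n1 : (1 - X : ℚ[X]) ≠ 0 := fun hc => by simp [hc] at e1
    have n2 : (1 + X : ℚ[X]) ≠ 0 := fun hc => by simp [hc] at e2
    rw [natDegree_mul (mul_ne_zero (pow_ne_zero _ X_ne_zero) (pow_ne_zero _ n1))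
      (pow_ne_zero _ n2), natDegree_mul (pow_ne_zero _ X_ne_zero) (pow_ne_zero _ n1),
      natDegree_pow, natDegree_pow, natDegree_pow, e1, e2, natDegree_X] at this
    omega
  -- The transform, the sign change and the transform again compose to y ↦ 1/y, so the polynomial is
  -- palindromic. Its low-order zero then lowers the degree to 2h - K, whereas the three coprime
  -- factors need degree at least 3K, contradicting 2h < 4K.
  have h5 : reflect (2 * h) (X ^ K * q) = X ^ K * q := by
    refine reflect_eq_of_eval hD {-1} fun y hy hy0 => ?_
    have hy1 : 1 + y ≠ 0 := fun hc => hy (by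
      rw [Finset.mem_singleton]; linarith)
    have hz : 1 + -((1 - y) / (1 + y)) = 2 * y / (1 + y) := by field_simp; ring
    have hz' : (1 - -((1 - y) / (1 + y))) / (1 + -((1 - y) / (1 + y))) = y⁻¹ := by
      rw [hz]; field_simp; ring
    have i1 := hinv y hy1
    have i2 := hinv (-((1 - y) / (1 + y))) (by rw [hz]; positivity)
    rw [hz', hz, hev] at i2
    have hp : (2 : ℚ) ^ h ≠ 0 := by positivity
    have hp' : (2 : ℚ) ^ h * 2 ^ h = 2 ^ (2 * h) := by rw [← pow_add, two_mul]
    have i3 : (2 : ℚ) ^ (2 * h) * (X ^ K * q).eval y =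
        2 ^ (2 * h) * (y ^ (2 * h) * (X ^ K * q).eval y⁻¹) := by
      rw [← hp', mul_assoc, i1, mul_left_comm, i2, hp', div_pow, mul_pow]
      field_simp
    exact (mul_left_cancel₀ (by positivity) i3).symm
  have h6 : (X ^ K * q).natDegree ≤ 2 * h - K := by
    rw [natDegree_le_iff_coeff_eq_zero]
    intro N hN
    rcases le_or_gt N (2 * h) with hN' | hN'
    · rw [← h5, coeff_reflect, revAt_le hN']
      exact hlow _ (by omega)
    · exact coeff_eq_zero_of_natDegree_lt (by omega)
  omega

theorem natDegree_codeForm_le (m : ℕ) (c : Fin (3 * m + 1) → ℚ) :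
    (codeForm m c).natDegree ≤ 24 * m + 2 := by
  refine natDegree_sum_le_of_forall_le _ _ fun j _ => ?_
  have h1 : (1 + X ^ 2 : ℚ[X]).natDegree ≤ 2 := by compute_degree
  have h2 : (X ^ 2 * (1 - X ^ 2) ^ 2 : ℚ[X]).natDegree ≤ 6 := by compute_degree
  refine (natDegree_mul_le_of_le (natDegree_mul_le_of_le (natDegree_C _).le
    (natDegree_pow_le_of_le _ h1)) (natDegree_pow_le_of_le _ h2)).trans ?_
  omega

theorem eval_codeForm (m : ℕ) (c : Fin (3 * m + 1) → ℚ) (y : ℚ) :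
    (codeForm m c).eval y = ∑ j : Fin (3 * m + 1), c j * (1 + y ^ 2) ^ (12 * m + 1 - 4 * (j : ℕ)) *
      (y ^ 2 * (1 - y ^ 2) ^ 2) ^ (j : ℕ) := by
  simp [codeForm, eval_finsetSum]

/-- Under y ↦ (1-y)/(1+y) the two generators reproduce themselves: 1+y² up to 2/(1+y)², and
y²(1-y²)² up to 16/(1+y)⁸. -/
theorem codeForm_invariant (m : ℕ) (c : Fin (3 * m + 1) → ℚ) {y : ℚ} (hy : 1 + y ≠ 0) :
    2 ^ (12 * m + 1) * (codeForm m c).eval y =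
      (1 + y) ^ (2 * (12 * m + 1)) * (codeForm m c).eval ((1 - y) / (1 + y)) := by
  rw [eval_codeForm, eval_codeForm, Finset.mul_sum, Finset.mul_sum]
  refine Finset.sum_congr rfl fun j _ => ?_
  obtain ⟨k, hk⟩ : ∃ k, 12 * m + 1 = k + 4 * (j : ℕ) := ⟨12 * m + 1 - 4 * j, by omega⟩
  rw [hk, Nat.add_sub_cancel]
  have e1 : 1 + ((1 - y) / (1 + y)) ^ 2 = 2 * (1 + y ^ 2) / (1 + y) ^ 2 := by
    field_simp; ring
  have e2 : ((1 - y) / (1 + y)) ^ 2 * (1 - ((1 - y) / (1 + y)) ^ 2) ^ 2 =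
      2 ^ 4 * (y ^ 2 * (1 - y ^ 2) ^ 2) / ((1 + y) ^ 2) ^ 4 := by
    field_simp; ring
  rw [e1, e2, div_pow, div_pow, mul_pow 2, mul_pow (2 ^ 4), pow_mul (1 + y) 2, pow_add ((1 + y) ^ 2),
    pow_add 2, pow_mul, pow_mul]
  field_simp

theorem eval_codeFormSq_rat (m : ℕ) (c : Fin (3 * m + 1) → ℚ) (u : ℚ) :
    (codeFormSq m c).eval u = ∑ j : Fin (3 * m + 1),
      c j * (1 + u) ^ (12 * m + 1 - 4 * (j : ℕ)) * (u * (1 - u) ^ 2) ^ (j : ℕ) := by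
  simp [codeFormSq, eval_finsetSum]

/-- With z = (1-y)/(1+y) and u = -z², the generators become 1+u = 4y/(1+y)² and u(1-u)² =
-4(1-y⁴)²/(1+y)⁸. -/
theorem shadowForm_transform (m : ℕ) (c : Fin (3 * m + 1) → ℚ) {y : ℚ} (hy : 1 + y ≠ 0) :
    2 ^ (12 * m + 1) * (shadowForm m c).eval y =
      (1 + y) ^ (24 * m + 2) * (codeFormSq m c).eval (-((1 - y) / (1 + y)) ^ 2) := by
  rw [eval_codeFormSq_rat, shadowForm, eval_finsetSum, Finset.mul_sum, Finset.mul_sum]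
  refine Finset.sum_congr rfl fun j _ => ?_
  simp only [eval_mul, eval_C, eval_pow, eval_one, eval_X, eval_sub]
  have hz : (2 : ℚ) ^ (12 * (m : ℤ) + 1 - 6 * ((j : ℕ) : ℤ)) =
      2 ^ (12 * m + 1) / 2 ^ (6 * (j : ℕ)) := by
    rw [zpow_sub₀ (by norm_num)]
    norm_cast
  obtain ⟨k, hk⟩ : ∃ k, 12 * m + 1 = k + 4 * (j : ℕ) := ⟨12 * m + 1 - 4 * j, by omega⟩
  rw [hz, show 24 * m + 2 = 2 * (12 * m + 1) by ring, hk, Nat.add_sub_cancel]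
  have e1 : 1 + -((1 - y) / (1 + y)) ^ 2 = 2 ^ 2 * y / (1 + y) ^ 2 := by
    field_simp; ring
  have e2 : -((1 - y) / (1 + y)) ^ 2 * (1 - -((1 - y) / (1 + y)) ^ 2) ^ 2 =
      (-1) * 2 ^ 2 * (1 - y ^ 4) ^ 2 / ((1 + y) ^ 2) ^ 4 := by
    field_simp; ring
  rw [e1, e2, div_pow, div_pow, mul_pow (2 ^ 2), mul_pow ((-1) * 2 ^ 2), mul_pow (-1),
    pow_mul (1 + y) 2, pow_add ((1 + y) ^ 2), pow_mul ((1 + y) ^ 2), pow_mul (1 - y ^ 4)]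
  have p1 : (2 : ℚ) ^ (k + 4 * (j : ℕ)) * (2 ^ (k + 4 * (j : ℕ)) / 2 ^ (6 * (j : ℕ))) =
      (2 ^ 2) ^ k * (2 ^ 2) ^ (j : ℕ) := by
    rw [← pow_mul, ← pow_mul, ← pow_add, mul_div_assoc', ← pow_add, div_eq_iff (by positivity),
      ← pow_add]
    congr 1
    ring
  generalize (1 - y ^ 4) ^ 2 = t
  calc _ = ((2 : ℚ) ^ (k + 4 * (j : ℕ)) * (2 ^ (k + 4 * (j : ℕ)) / 2 ^ (6 * (j : ℕ)))) *
        ((-1) ^ (j : ℕ) * c j * y ^ k * t ^ (j : ℕ)) := by ring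
    _ = _ := by
      rw [p1]
      field_simp

/-- Gleason's theorem for singly even self-dual codes of length `24m + 2`. -/
theorem IsSelfDual.exists_codeForm {m : ℕ} {C : Code (24 * m + 2)} (hC : IsSelfDual C)
    (hdim : Module.finrank (ZMod 2) C = 12 * m + 1) :
    ∃ c : Fin (3 * m + 1) → ℚ,
      weightEnumerator (C : Set (Fin (24 * m + 2) → ZMod 2)) = codeForm m c := by
  classical
  set W := weightEnumerator (C : Set (Fin (24 * m + 2) → ZMod 2)) with hW
  obtain ⟨c, hc⟩ := codeCoeffMap_surjective m fun i => W.coeff (2 * i)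
  -- Even indices below 6m+1 are matched by the choice of c and odd ones vanish on both sides, so K
  -- = 6m+1; the degree 24m+2 is just below 4K = 24m+4.
  refine ⟨c, sub_eq_zero.mp (eq_zero_of_invariant (h := 12 * m + 1) (K := 6 * m + 1)
    (by omega) ?_ ?_ ?_ ?_)⟩
  · rw [show 2 * (12 * m + 1) = 24 * m + 2 by ring]
    exact (natDegree_sub_le _ _).trans
      (max_le (natDegree_weightEnumerator_le _) (natDegree_codeForm_le m c))
  · rw [sub_comp]
    congr 1
    · rw [hW, weightEnumerator, Polynomial.sum_comp]
      refine Finset.sum_congr rfl fun x hx => ?_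
      rw [Finset.mem_filter] at hx
      rw [X_pow_comp, Even.neg_pow (even_iff_two_dvd.mpr (hC.two_dvd_hammingNorm hx.2))]
    · rw [codeForm_eq_expand, expand_eq_comp_X_pow, comp_assoc]
      simp
  · intro y hy
    have hcard : (Fintype.card C : ℚ) = 2 ^ (12 * m + 1) := by
      rw [Module.card_eq_pow_finrank (K := ZMod 2), hdim, ZMod.card]
      push_cast
      rfl
    rw [eval_sub, eval_sub, mul_sub, mul_sub, codeForm_invariant m c hy, ← hcard, hW,
      hC.card_mul_eval_weightEnumerator hy, show 2 * (12 * m + 1) = 24 * m + 2 by ring]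
  · intro k hk
    rw [coeff_sub, sub_eq_zero]
    rcases Nat.even_or_odd' k with ⟨i, rfl | rfl⟩
    · rw [coeff_codeForm]
      exact (congrFun hc ⟨i, by omega⟩).symm
    · rw [codeForm_eq_expand, coeff_expand (by norm_num), if_neg (by omega)]
      exact coeff_weightEnumerator_eq_zero fun x hx he => by
        have := hC.two_dvd_hammingNorm hx
        omega

/-- The weight enumerator of the shadow. -/
theorem IsSinglyEvenSelfDual.weightEnumerator_shadow {m : ℕ} {C : Code (24 * m + 2)}
    (hC : IsSinglyEvenSelfDual C) (hdim : Module.finrank (ZMod 2) C = 12 * m + 1)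
    {c : Fin (3 * m + 1) → ℚ}
    (hc : weightEnumerator (C : Set (Fin (24 * m + 2) → ZMod 2)) = codeForm m c) :
    weightEnumerator (shadow C) = shadowForm m c := by
  classical
  have hcard : (Fintype.card C : ℚ) = 2 ^ (12 * m + 1) := by
    rw [Module.card_eq_pow_finrank (K := ZMod 2), hdim, ZMod.card]
    push_cast
    rfl
  -- In the variable u = y² a codeword contributes u^(wt/2); at u = -z² this produces the sign
  -- (-1)^(wt/2) of the shadow identity.
  have hP : codeFormSq m c = ∑ x : Fin (24 * m + 2) → ZMod 2 with
      x ∈ (C : Set (Fin (24 * m + 2) → ZMod 2)), X ^ (hammingNorm x / 2) := by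
    refine expand_injective (R := ℚ) (n := 2) (by norm_num) ?_
    rw [← codeForm_eq_expand, ← hc, map_sum, weightEnumerator]
    refine Finset.sum_congr (by congr) fun x hx => ?_
    rw [Finset.mem_filter] at hx
    rw [map_pow, expand_X, ← pow_mul, Nat.mul_div_cancel' (hC.1.two_dvd_hammingNorm hx.2)]
  refine eq_of_eval_eq_off {-1} fun y hy => ?_
  have hy1 : 1 + y ≠ 0 := fun h => hy (by rw [Finset.mem_singleton]; linarith)
  have h1 := hC.card_mul_eval_weightEnumerator_shadow hy1
  have h2 := shadowForm_transform m c hy1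
  have h3 : (codeFormSq m c).eval (-((1 - y) / (1 + y)) ^ 2) =
      ∑ x : C, (-1) ^ (hammingNorm (x : Fin (24 * m + 2) → ZMod 2) / 2) *
        ((1 - y) / (1 + y)) ^ hammingNorm (x : Fin (24 * m + 2) → ZMod 2) := by
    rw [hP, eval_finsetSum, Finset.sum_subtype (p := fun x => x ∈ C) _ (by simp)]
    refine Finset.sum_congr rfl fun x _ => ?_
    rw [eval_pow, eval_X, neg_pow, ← pow_mul,
      Nat.mul_div_cancel' (hC.1.two_dvd_hammingNorm x.2)]
  rw [h3, ← h1, hcard] at h2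
  exact (mul_left_cancel₀ (by positivity) h2).symm

/-- The weight enumerators of a code with minimal shadow that meets the bound are the ones given
by the admissible coefficients. -/
theorem exists_isAdmissible_of_code {m : ℕ} (hm : 1 ≤ m) {C : Code (24 * m + 2)}
    (hC : IsSinglyEvenSelfDual C) (hpar : HasParameters C (12 * m + 1) (4 * m + 2))
    (hmin : HasMinimalShadow C) :
    ∃ c : Fin (3 * m + 1) → ℚ, IsAdmissible m c ∧
      weightEnumerator (C : Set (Fin (24 * m + 2) → ZMod 2)) = codeForm m c ∧
      weightEnumerator (shadow C) = shadowForm m c := by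
  obtain ⟨c, hc⟩ := hC.1.exists_codeForm hpar.1
  have hs := hC.weightEnumerator_shadow hpar.1 hc
  refine ⟨c, ?_, hc, hs⟩
  have hd (x) (hx : x ∈ C) (h0 : x ≠ 0) : 4 * m + 2 ≤ hammingNorm x := hpar.2.2 ⟨x, hx, h0, rfl⟩
  have hr : minimalShadowWeight (24 * m + 2) = 1 := by
    rw [minimalShadowWeight, show (24 * m + 2) % 8 = 2 by omega]
    rfl
  rw [HasMinimalShadow, hr] at hmin
  obtain ⟨e, heS, he0, he1⟩ := hmin.1
  -- The nonzero codeword e + v has weight at least 4m+2, and e has weight 1. So e is the only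
  -- shadow vector of weight 1, and the weights 5, …, 4m-3 do not occur.
  have hv (v) (hv : v ∈ shadow C) (hne : v ≠ e) : 4 * m + 1 ≤ hammingNorm v := by
    have h1 := hC.add_mem_of_mem_shadow heS hv
    have h2 : e + v ≠ 0 := fun h => hne (by
      have := add_eq_zero_iff_eq_neg.mp h
      rw [this]
      ext i
      rw [Pi.neg_apply, ZMod.neg_eq_self_mod_two])
    have h3 := hd _ h1 h2
    have h4 := hammingNorm_add e v
    omega
  refine ⟨?_, fun i h1 h2 => ?_, ?_, fun i h1 h2 => ?_⟩
  · rw [← hc]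
    exact coeff_weightEnumerator_eq_one C.zero_mem hammingNorm_zero
      fun y _ hy => hammingNorm_eq_zero.mp hy
  · rw [← hc]
    refine coeff_weightEnumerator_eq_zero fun x hx hk => ?_
    have := hd x hx fun h => by rw [h, hammingNorm_zero] at hk; omega
    omega
  · rw [← hs]
    refine coeff_weightEnumerator_eq_one heS he1 fun y hy hy1 => ?_
    by_contra hne
    have := hv y hy hne
    omega
  · rw [← hs]
    refine coeff_weightEnumerator_eq_zero fun x hx hk => ?_
    have := hv x hx fun h => by rw [h, he1] at hk; omega
    omega

-- Kernel evaluation of the certificate for each m. The recurrences producing the candidate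
-- coefficients need no proof, since the certificate tests the resulting list itself.
set_option maxHeartbeats 4000000 in
theorem check_eq_true {m : ℕ} (h₁ : 1 ≤ m) (h₂ : m ≤ 154) : check m = true := by
  interval_cases m <;> decide +kernel

theorem IsAdmissible.coeff_codeForm_neg {m : ℕ} {c : Fin (3 * m + 1) → ℚ}
    (hc : IsAdmissible m c) (hm : 155 ≤ m) : (codeForm m c).coeff (2 * (2 * m + 4)) < 0 := by
  rw [codeForm_eq_expand, coeff_expand (by norm_num), if_pos (dvd_mul_right _ _),
    Nat.mul_div_cancel_left _ (by norm_num)]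
  exact hc.coeff_codeFormSq_neg hm

end BinaryCode

end

theorem mainTheorem1 (m : ℕ) (hm : 1 ≤ m) :
    -- the formulas and the conditions on `a_i`, `b_i` determine the `c_j`
    (∃! c : Fin (3 * m + 1) → ℚ, BinaryCode.IsAdmissible m c) ∧
    -- every code in question, and its shadow, has the weight enumerators so determined
    (∀ C : BinaryCode.Code (24 * m + 2),
      BinaryCode.IsSinglyEvenSelfDual C →
      BinaryCode.HasParameters C (12 * m + 1) (4 * m + 2) →
      BinaryCode.HasMinimalShadow C →
      ∃ c : Fin (3 * m + 1) → ℚ, BinaryCode.IsAdmissible m c ∧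
        BinaryCode.weightEnumerator (C : Set (Fin (24 * m + 2) → ZMod 2)) =
          BinaryCode.codeForm m c ∧
        BinaryCode.weightEnumerator (BinaryCode.shadow C) = BinaryCode.shadowForm m c) ∧
    -- these have nonnegative integer coefficients if and only if `m ≤ 154`
    ((∀ c : Fin (3 * m + 1) → ℚ, BinaryCode.IsAdmissible m c →
        BinaryCode.HasNonnegIntCoeffs (BinaryCode.codeForm m c) ∧
        BinaryCode.HasNonnegIntCoeffs (BinaryCode.shadowForm m c)) ↔ m ≤ 154) ∧
    -- no such code exists for `m ≥ 155`
    (155 ≤ m →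
      ¬ ∃ C : BinaryCode.Code (24 * m + 2),
        BinaryCode.IsSinglyEvenSelfDual C ∧
        BinaryCode.HasParameters C (12 * m + 1) (4 * m + 2) ∧
        BinaryCode.HasMinimalShadow C) := by
  refine ⟨BinaryCode.existsUnique_isAdmissible hm, fun C hC hpar hmin =>
    BinaryCode.exists_isAdmissible_of_code hm hC hpar hmin, ⟨fun h => ?_, fun h c hc => ?_⟩, ?_⟩
  · by_contra hlt
    obtain ⟨c, hc⟩ := (BinaryCode.existsUnique_isAdmissible hm).exists
    obtain ⟨k, hk⟩ := (h c hc).1 (2 * (2 * m + 4))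
    have hneg := hc.coeff_codeForm_neg (by omega)
    rw [hk] at hneg
    exact absurd hneg (not_lt.mpr k.cast_nonneg)
  · obtain ⟨c', hc', h'⟩ :=
      BinaryCode.exists_of_certificate hm (BinaryCode.check_eq_true hm h)
    rwa [(BinaryCode.existsUnique_isAdmissible hm).unique hc hc']
  · rintro hlt ⟨C, hC, hpar, hmin⟩
    obtain ⟨c, hc, hW, -⟩ := BinaryCode.exists_isAdmissible_of_code hm hC hpar hmin
    have hneg := hc.coeff_codeForm_neg hlt
    rw [← hW] at hneg
    exact absurd hneg (not_lt.mpr (BinaryCode.coeff_weightEnumerator_nonneg _ _))
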